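/- Let $n\ge 3$. A bounded domain $D\subset\mathbb R^n$ is *strictly starlike w.r.t. the origin* if every (closed) ray emanating from $0$ meets $\partial D$ at exactly one point. For such $D$ let $\mathcal M=\partial D$ and let $\varphi:S^{n-1}\to\mathcal M$, $\varphi(x)=r(x)x$, $r(x)>0$, be its polar parametrization. For $a>0$ let $\varphi_a:\mathbb R^n\to\mathbb R^n$, $\varphi_a(x)=|x|^a\varphi(x/|x|)$, $\varphi_a(0)=0$. For distinct $x,z\in\mathcal M$ let $\alpha(z,x)\in[0,\pi/2]$ be the acute angle which the segment $[z,x]$ makes with the ray from $0$ through $x$, and put $\alpha(x)=\liminf_{z\to x,\,z\in\mathcal M\setminus\{x\}}\alpha(z,x)$. For $\alpha\in(0,\pi/2]$, $D$ satisfies the *$\alpha$-tangent condition* if $\alpha(x)\ge\alpha$ for every $x\in\mathcal M$. $\mathrm{Lip}(f)$ is the smallest Lipschitz constant of $f$, and $f$ is *$L$-bi-Lipschitz* if it is a homeomorphism with $|x-y|/L\le|f(x)-f(y)|\le L|x-y|$ for all $x,y$. Let $\Lambda_f(x)$ and $\lambda_f(x)$ be the maximum and minimum of $|f'(x)h|$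 over $|h|=1$. A homeomorphism $f$ of $\mathbb R^n$ is *quasiconformal* if it is ACL, differentiable a.e., and for some $C$ satisfies $\Lambda_f(x)^n/C\le|J(x,f)|\le C\lambda_f(x)^n$ for a.e. $x$; it is *$K$-quasiconformal* if moreover $\Lambda_f(x)\le K\lambda_f(x)$ for a.e. $x$. Put $$C(\alpha)=\tfrac12\left(\sqrt{\csc^2\alpha-1}+\sqrt{\csc^2\alpha+3}\right),\qquad K_a(\alpha)=\frac1{4a}\left(\sqrt{(a-1)^2+\cot^2\alpha}+\sqrt{(1+a)^2+\cot^2\alpha}\right)^2,$$ $$L_1=|r|_{\max}\,C(\alpha),\qquad L_2=\frac{1}{|r|_{\min}}\,C(\alpha),\qquad L=\max\{L_1,L_2\},$$ where $|r|_{\max},|r|_{\min}$ are the maximum and minimum of $r$ on $S^{n-1}$. **(a)** For $a>0$, $\varphi_a$ is bi-Lipschitz (with some constant) if and only if $a=1$ and $D$ satisfies the $\alpha$-tangent condition for some $\alpha\in(0,\pi/2]$. If $D$ satisfies the $\alpha$-tangent condition, then $\varphi_1$ is an $L$-bi-Lipschitz homeomorphism of $\mathbb R^n$, with $$\mathrm{Lip}(\varphi_1)=\sup_{x\in\mathcal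 M}|x|\,C(\alpha(x))\le L_1,\qquad \mathrm{Lip}(\varphi_1^{-1})=\sup_{x\in\mathcal M}\frac{1}{|x|}\,C(\alpha(x))\le L_2 .$$ Moreover, for each fixed $d>0$, $L\to\max\{d,1/d\}$ as $\alpha\to\pi/2$, uniformly over all $D$ as above that satisfy the $\alpha$-tangent condition and have $\mathrm{dist}(\mathcal M,0)=d$. **(b)** For $a>0$, $\varphi_a$ is $K$-quasiconformal for some $K$ if and only if $D$ satisfies the $\alpha$-tangent condition for some $\alpha\in(0,\pi/2]$. More precisely, for all $a>0$ and $\alpha\in(0,\pi/2]$, $\varphi_a$ is $K_a(\alpha)$-quasiconformal if and only if $D$ satisfies the $\alpha$-tangent condition with this $\alpha$; and if $\alpha$ is the largest angle for which $D$ satisfies the $\alpha$-tangent condition, then $K_a(\alpha)$ is the smallest $K$ for which $\varphi_a$ is $K$-quasiconformal. For every $\alpha\in(0,\pi/2]$ the minimum of $K_a(\alpha)$ over $a>0$ is attained at $a=\csc\alpha$ and equals $\cot(\alpha/2)$. If $D$ satisfies the $\alpha$-tangent condition, then $\varphi_{\csc\alpha}$ is $\cot(\alpha/2)$-quasiconformal;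 and if $\alpha$ is the largest such angle, then $\cot(\alpha/2)$ is the smallest $K$ for which some $\varphi_a$, $a>0$, is $K$-quasiconformal. -/

import Mathlib

open MeasureTheory Set Filter
open scoped Topology NNReal ENNReal

noncomputable section

namespace RadialStretch

/-- `ℝⁿ` with the Euclidean norm. -/
abbrev E (n : ℕ) : Type := EuclideanSpace ℝ (Fin n)

/-! ### Starlike domains and the tangent condition -/

/-- A bounded domain `D` (open, connected, nonempty) is strictly starlike with respect to `p` if
every closed ray emanating from `p` meets the boundary of `D` at exactly one point. -/
structure StrictlyStarlike {n : ℕ} (p : E n) (D : Set (E n)) : Prop where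
  isOpen : IsOpen D
  isConnected : IsConnected D
  isBounded : Bornology.IsBounded D
  existsUnique_frontier : ∀ v : E n, v ≠ 0 →
    ∃! z : E n, z ∈ frontier D ∧ ∃ t : ℝ, 0 ≤ t ∧ z = p + t • v

/-- The acute angle, in `[0, π/2]`, which the segment `[z, x]` makes with the ray from `0`
through `x`. -/
def acuteAngle {n : ℕ} (z x : E n) : ℝ :=
  min (InnerProductGeometry.angle (z - x) x) (Real.pi - InnerProductGeometry.angle (z - x) x)

/-- `α(x) = liminf_{z → x} α(z, x)`, where `z ≠ x` ranges over the boundary of `D`. -/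
def tangentAngle {n : ℕ} (D : Set (E n)) (x : E n) : ℝ :=
  liminf (fun z : E n => acuteAngle z x) (𝓝[frontier D \ {x}] x)

/-- The `α`-tangent condition, for an angle `α ∈ (0, π/2]`. -/
def TangentCondition {n : ℕ} (D : Set (E n)) (α : ℝ) : Prop :=
  (0 < α ∧ α ≤ Real.pi / 2) ∧ ∀ x ∈ frontier D, α ≤ tangentAngle D x

/-! ### The polar parametrization and its radial extensions -/

/-- `r(x)`: the positive number `t` with `t • x ∈ ∂D`. For `D` strictly starlike with respect to
`0` and `x ≠ 0` there is exactly one, so that the supremum is over a one-point set. -/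
def polarRadius {n : ℕ} (D : Set (E n)) (x : E n) : ℝ :=
  sSup {t : ℝ | 0 < t ∧ t • x ∈ frontier D}

/-- The polar parametrization `φ(x) = r(x) x` of `∂D` by the unit sphere; on the unit sphere it
is the inverse of the radial projection `z ↦ z / |z|` of `∂D`. -/
def polarParam {n : ℕ} (D : Set (E n)) (x : E n) : E n :=
  polarRadius D x • x

/-- The radial extension `φ_a(x) = |x|ᵃ φ(x / |x|)`, with `φ_a(0) = 0`. -/
def radialExt {n : ℕ} (D : Set (E n)) (a : ℝ) (x : E n) : E n :=
  if x = 0 then 0 else (‖x‖ ^ a) • polarParam D (‖x‖⁻¹ • x)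

/-- `|r|_max`, the maximum of `r` over the unit sphere. -/
def rMax {n : ℕ} (D : Set (E n)) : ℝ :=
  ⨆ u : Metric.sphere (0 : E n) 1, polarRadius D u

/-- `|r|_min`, the minimum of `r` over the unit sphere. -/
def rMin {n : ℕ} (D : Set (E n)) : ℝ :=
  ⨅ u : Metric.sphere (0 : E n) 1, polarRadius D u

/-! ### Lipschitz and bi-Lipschitz maps -/

/-- `Lip(f)`, the smallest Lipschitz constant of `f` (`∞` if `f` is not Lipschitz). -/
def lip {X Y : Type*} [PseudoEMetricSpace X] [PseudoEMetricSpace Y] (f : X → Y) : ℝ≥0∞ :=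
  ⨅ (L : ℝ≥0) (_ : LipschitzWith L f), (L : ℝ≥0∞)

/-- `f` is `L`-bi-Lipschitz: a homeomorphism with
`d(x, y) / L ≤ d(f x, f y) ≤ L d(x, y)` for all `x`, `y`. -/
def IsBiLipschitzWith {X Y : Type*} [PseudoMetricSpace X] [PseudoMetricSpace Y]
    (L : ℝ) (f : X → Y) : Prop :=
  0 < L ∧ IsHomeomorph f ∧
    ∀ x y : X, dist x y / L ≤ dist (f x) (f y) ∧ dist (f x) (f y) ≤ L * dist x y

/-! ### Quasiconformal maps of `ℝⁿ` -/

/-- The point of `ℝⁿ` with `i`-th coordinate `t` and the other coordinates given by `y`. -/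
def insertCoord {n : ℕ} (i : Fin n) (t : ℝ) (y : {j : Fin n // j ≠ i} → ℝ) : E n :=
  WithLp.toLp 2 (fun j => if h : j = i then t else y ⟨j, h⟩)

/-- `f` is ACL (absolutely continuous on lines): it is continuous and, for every closed interval
`Q = ∏ⱼ [cⱼ, dⱼ]` of `ℝⁿ`, it is absolutely continuous on almost every segment in `Q` parallel to
the coordinate axes, with respect to `(n - 1)`-dimensional Lebesgue measure on the faces. -/
def IsACL {n : ℕ} (f : E n → E n) : Prop :=
  Continuous f ∧
    ∀ c d : Fin n → ℝ, c ≤ d → ∀ i : Fin n, ∀ᵐ y : {j : Fin n // j ≠ i} → ℝ,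
      (∀ j : {j : Fin n // j ≠ i}, y j ∈ Icc (c j) (d j)) →
        AbsolutelyContinuousOnInterval (fun t => f (insertCoord i t y)) (c i) (d i)

/-- `Λ_f(x) = max {|f'(x) h| : |h| = 1}`, the operator norm of the derivative. -/
def maxStretch {n : ℕ} (f : E n → E n) (x : E n) : ℝ :=
  ‖fderiv ℝ f x‖

/-- `λ_f(x) = min {|f'(x) h| : |h| = 1}`. -/
def minStretch {n : ℕ} (f : E n → E n) (x : E n) : ℝ :=
  ⨅ h : Metric.sphere (0 : E n) 1, ‖fderiv ℝ f x h‖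

/-- The Jacobian `J(x, f)`. -/
def jacobian {n : ℕ} (f : E n → E n) (x : E n) : ℝ :=
  (fderiv ℝ f x).det

/-- The analytic definition of quasiconformality of a homeomorphism of `ℝⁿ` onto itself:
ACL, differentiable almost everywhere, and, for some constant `C`,
`Λ_f(x)ⁿ / C ≤ |J(x, f)| ≤ C λ_f(x)ⁿ` for almost every `x`. -/
def IsQuasiconformal {n : ℕ} (f : E n → E n) : Prop :=
  IsHomeomorph f ∧ IsACL f ∧ (∀ᵐ x : E n, DifferentiableAt ℝ f x) ∧
    ∃ C : ℝ, 0 < C ∧ ∀ᵐ x : E n,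
      maxStretch f x ^ n / C ≤ |jacobian f x| ∧ |jacobian f x| ≤ C * minStretch f x ^ n

/-- A quasiconformal map `f` is `K`-quasiconformal if its linear dilatation satisfies
`H(f'(x)) = Λ_f(x) / λ_f(x) ≤ K` for almost every `x`. The condition is written without division;
recall that `Λ_f(x) = 0` wherever the inequalities of quasiconformality hold and `λ_f(x) = 0`. -/
def IsQuasiconformalWith {n : ℕ} (K : ℝ) (f : E n → E n) : Prop :=
  IsQuasiconformal f ∧ ∀ᵐ x : E n, maxStretch f x ≤ K * minStretch f x

/-! ### The explicit constants -/

/-- The cosecant. -/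
def csc (α : ℝ) : ℝ := 1 / Real.sin α

/-- `(√(csc² α - 1) + √(csc² α + 3)) / 2`. -/
def lipFactor (α : ℝ) : ℝ :=
  (√(csc α ^ 2 - 1) + √(csc α ^ 2 + 3)) / 2

/-- `L₁ = (|r|_max / 2) (√(csc² α - 1) + √(csc² α + 3))`. -/
def lipL1 {n : ℕ} (D : Set (E n)) (α : ℝ) : ℝ :=
  rMax D * lipFactor α

/-- `L₂ = (1 / (2 |r|_min)) (√(csc² α - 1) + √(csc² α + 3))`. -/
def lipL2 {n : ℕ} (D : Set (E n)) (α : ℝ) : ℝ :=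
  1 / rMin D * lipFactor α

/-- `L = max {L₁, L₂}`. -/
def lipL {n : ℕ} (D : Set (E n)) (α : ℝ) : ℝ :=
  max (lipL1 D α) (lipL2 D α)

/-- `K_a = (1 / (4 a)) (√((a - 1)² + cot² α) + √((1 + a)² + cot² α))²`. -/
def qcK (a α : ℝ) : ℝ :=
  1 / (4 * a) * (√((a - 1) ^ 2 + Real.cot α ^ 2) + √((1 + a) ^ 2 + Real.cot α ^ 2)) ^ 2

end RadialStretch

end

open RadialStretch

namespace RadialStretch

/-! ### Absolutely continuous functions of one variable -/

/-! Let ψ(x) = log r(x/|x|), which is homogeneous of degree 0 (`logRadius`). Then φ_a(x) = |x|^(a-1)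
e^ψ(x) x, a map that preserves rays and satisfies log|φ_a(x)| = a log|x| + ψ(x) (`stretch`). Where ψ
is differentiable, put u = x/|x| and G = |x|∇ψ(x). Homogeneity gives G ⟂ u, and the derivative is
c(h + ((a-1)⟨u,h⟩ + ⟨G,h⟩)u) with c = |x|^(a-1) e^ψ(x). Its extreme singular values are cS and ca/S,
where S = `singMax a ‖G‖`, and its determinant is cⁿa. The linear dilatation is therefore S²/a,
which is K_a(α) when |G| = cot α. For a = 1 the norm is e^ψ S, and S = C(α) when |G| = cot α.

The geometric link is `tangentCondition_iff`: the α-tangent condition says exactly that limsup |ψ(y)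
- ψ(x)|/|y - x| ≤ cot α/|x| at every x ≠ 0. It holds because, to first order, log|z| - log|x| is the
radial component of z - x divided by |x|, and the tangent angle compares this component with the
orthogonal one.

The remaining work passes between bounds at every point and bounds almost everywhere. Pointwise
Lipschitz bounds make ψ locally Lipschitz, so Rademacher's theorem and the singular values apply.
Conversely, for locally Lipschitz ψ an almost everywhere gradient bound gives the pointwise bound
everywhere, by Fubini over parallel segments (`pointwiseLip_of_ae`). If φ_a is only quasiconformal,
local Lipschitz continuity of ψ is first extracted from the ACL property
(`locallyLipschitzOn_of_isACL`). Sharpness follows from the strict monotonicity and continuity of S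
in |G|.

The best a comes from K_a + 1/K_a = a + csc²α/a. The limit of L comes from the oscillation of ψ on
the sphere being at most 8 cot α. -/

theorem _root_.AbsolutelyContinuousOnInterval.lipschitzOnWith_comp {X Y : Type*}
    [PseudoMetricSpace X] [PseudoMetricSpace Y] {f : ℝ → X} {g : X → Y} {K : ℝ≥0} {s : Set X}
    {a b : ℝ} (hf : AbsolutelyContinuousOnInterval f a b) (hg : LipschitzOnWith K g s)
    (hs : MapsTo f (uIcc a b) s) : AbsolutelyContinuousOnInterval (fun t => g (f t)) a b := by
  unfold AbsolutelyContinuousOnInterval at hf ⊢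
  refine squeeze_zero' (Eventually.of_forall fun _ => Finset.sum_nonneg fun i _ => dist_nonneg) ?_
    (by simpa using hf.const_mul (K : ℝ))
  rw [eventually_inf_principal]
  filter_upwards with E hE
  rw [Finset.mul_sum]
  exact Finset.sum_le_sum fun i hi =>
    hg.dist_le_mul _ (hs (hE.1 i hi).1) _ (hs (hE.1 i hi).2)

theorem _root_.AbsolutelyContinuousOnInterval.abs_sub_le_of_ae_deriv_le {f : ℝ → ℝ} {a b C : ℝ}
    (hf : AbsolutelyContinuousOnInterval f a b)
    (hC : ∀ᵐ t, t ∈ uIoc a b → |deriv f t| ≤ C) : |f b - f a| ≤ C * |b - a| := by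
  rw [← hf.integral_deriv_eq_sub]
  exact intervalIntegral.norm_integral_le_of_norm_le_const_ae (f := deriv f) hC

/-! ### Pointwise Lipschitz bounds -/

section PointwiseLip

variable {V W : Type*} [NormedAddCommGroup V] [NormedAddCommGroup W]

/-- The pointwise Lipschitz constant `limsup_{y → x} |f y - f x| / |y - x|` is at most `k`. -/
def PointwiseLip (f : V → W) (x : V) (k : ℝ) : Prop :=
  ∀ k' > k, ∀ᶠ y in 𝓝 x, ‖f y - f x‖ ≤ k' * ‖y - x‖

theorem PointwiseLip.mono {f : V → W} {x : V} {k l : ℝ} (h : PointwiseLip f x k) (hkl : k ≤ l) :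
    PointwiseLip f x l := fun k' hk' => h k' (hkl.trans_lt hk')

theorem pointwiseLip_of_forall_gt {f : V → W} {x : V} {k : ℝ}
    (h : ∀ k' > k, PointwiseLip f x k') : PointwiseLip f x k := fun k' hk' => by
  obtain ⟨l, hl, hl'⟩ := exists_between hk'
  exact h l hl k' hl'

theorem PointwiseLip.neg {f : V → W} {x : V} {k : ℝ} (h : PointwiseLip f x k) :
    PointwiseLip (fun y => -f y) x k := fun k' hk' => by
  filter_upwards [h k' hk'] with y hy
  rwa [← neg_sub', norm_neg]

theorem PointwiseLip.continuousAt {f : V → W} {x : V} {k : ℝ} (h : PointwiseLip f x k) :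
    ContinuousAt f x := by
  rw [ContinuousAt, tendsto_iff_norm_sub_tendsto_zero]
  refine squeeze_zero' (Eventually.of_forall fun _ => norm_nonneg _) (h (k + 1) (by linarith)) ?_
  have : Continuous fun y : V => (k + 1) * ‖y - x‖ := by fun_prop
  simpa using this.tendsto x

variable [NormedSpace ℝ V]

theorem PointwiseLip.norm_fderiv_le [NormedSpace ℝ W] {f : V → W} {x : V} {k : ℝ} (hk : 0 ≤ k)
    (h : PointwiseLip f x k) {f' : V →L[ℝ] W} (hf : HasFDerivAt f f' x) : ‖f'‖ ≤ k :=
  le_of_forall_gt_imp_ge_of_dense fun k' hk' => hf.le_of_lip' (hk.trans hk'.le) (h k' hk')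

/-- A mean value inequality: pointwise Lipschitz bounds on a segment integrate. -/
theorem norm_sub_le_of_pointwiseLip {f : V → W} {k : ℝ} {x y : V}
    (h : ∀ z ∈ segment ℝ x y, PointwiseLip f z k) : ‖f y - f x‖ ≤ k * ‖y - x‖ := by
  rcases eq_or_ne x y with rfl | hxy
  · simp
  have hd : 0 < ‖y - x‖ := norm_sub_pos_iff.2 hxy.symm
  refine le_of_forall_pos_le_add fun ε hε => ?_
  have hl : ∀ t ∈ Icc (0 : ℝ) 1, x + t • (y - x) ∈ segment ℝ x y := fun t ht => by
    rw [segment_eq_image']; exact ⟨t, ht, rfl⟩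
  set g : ℝ → W := fun t => f (x + t • (y - x)) - f x with hg
  have hgc : ContinuousOn g (Icc 0 1) := fun t ht => by
    have h1 : ContinuousAt f (x + t • (y - x)) := (h _ (hl t ht)).continuousAt
    have h2 : ContinuousAt (fun t : ℝ => x + t • (y - x)) t := by fun_prop
    exact ((ContinuousAt.comp (f := fun t : ℝ => x + t • (y - x)) h1 h2).sub
      continuousAt_const).continuousWithinAt
  -- The slack ε makes the slope of the linear barrier strictly larger than the bound on the growth
  -- of ‖g‖, as the fencing argument requires.
  have key := image_norm_le_of_liminf_right_slope_norm_lt_deriv_boundary (a := 0) (b := 1)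
    (f := g) (f' := fun _ => k * ‖y - x‖) (B := fun t => (k * ‖y - x‖ + ε) * t)
    (B' := fun _ => k * ‖y - x‖ + ε) hgc ?_ (by simp [hg]) (by fun_prop)
    (fun t _ => by simpa using ((hasDerivAt_id t).const_mul (k * ‖y - x‖ + ε)).hasDerivWithinAt)
    (fun t _ _ => by linarith) (right_mem_Icc.2 zero_le_one)
  · simpa [hg] using key
  · intro t ht r hr
    have hk' : k < r / ‖y - x‖ := by rwa [lt_div_iff₀ hd]
    obtain ⟨k', hk1, hk2⟩ := exists_between hk'
    rw [lt_div_iff₀ hd] at hk2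
    have h2 : Tendsto (fun s : ℝ => x + s • (y - x)) (𝓝[>] t) (𝓝 (x + t • (y - x))) := by
      have : Continuous fun s : ℝ => x + s • (y - x) := by fun_prop
      exact (this.tendsto t).mono_left nhdsWithin_le_nhds
    refine Eventually.frequently ?_
    filter_upwards [h2.eventually (h _ (hl t ⟨ht.1, ht.2.le⟩) k' hk1), self_mem_nhdsWithin]
      with s hs hts
    have hts' : 0 < s - t := sub_pos.2 hts
    rw [slope_def_field, div_lt_iff₀ hts']
    have e1 : x + s • (y - x) - (x + t • (y - x)) = (s - t) • (y - x) := by module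
    rw [e1, norm_smul, Real.norm_of_nonneg hts'.le] at hs
    calc ‖g s‖ - ‖g t‖ ≤ ‖g s - g t‖ := norm_sub_norm_le _ _
      _ = ‖f (x + s • (y - x)) - f (x + t • (y - x))‖ := by simp [hg]
      _ ≤ k' * ((s - t) * ‖y - x‖) := hs
      _ = (k' * ‖y - x‖) * (s - t) := by ring
      _ < r * (s - t) := by gcongr

theorem lipschitzOnWith_of_pointwiseLip {f : V → W} {k : ℝ} {s : Set V} (hs : Convex ℝ s)
    (h : ∀ z ∈ s, PointwiseLip f z k) : LipschitzOnWith k.toNNReal f s :=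
  LipschitzOnWith.of_dist_le_mul fun x hx y hy => by
    rw [dist_eq_norm, dist_eq_norm]
    refine (norm_sub_le_of_pointwiseLip fun z hz => h z (hs.segment_subset hy hx hz)).trans ?_
    gcongr
    exact Real.le_coe_toNNReal k

end PointwiseLip

/-! ### Lipschitz constants from almost everywhere bounds of the derivative -/

section AEBound

variable {V : Type*} [NormedAddCommGroup V] [NormedSpace ℝ V] [FiniteDimensional ℝ V]
  [MeasurableSpace V] [BorelSpace V] {μ : Measure V} [μ.IsAddHaarMeasure]

/-- Fubini on V × ℝ: for each fixed t the exceptional set of v is a translate of a null set, hence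
null by invariance of μ. -/
theorem ae_ae_add_smul {p : V → Prop} (hp : ∀ᵐ x ∂μ, p x) (w : V) :
    ∀ᵐ v ∂μ, ∀ᵐ t : ℝ, p (v + t • w) := by
  obtain ⟨N, hN, hNm, hN0⟩ := exists_measurable_superset_of_null (ae_iff.1 hp)
  have hmeas : MeasurableSet {q : V × ℝ | q.1 + q.2 • w ∈ N} := by
    have : Measurable fun q : V × ℝ => q.1 + q.2 • w := by fun_prop
    exact this hNm
  have h0 : (μ.prod volume) {q : V × ℝ | q.1 + q.2 • w ∈ N} = 0 := by
    rw [Measure.prod_apply_symm hmeas]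
    simp only [lintegral_eq_zero_iff (measurable_measure_prodMk_right hmeas)]
    refine Eventually.of_forall fun t => ?_
    have : (fun v : V => (v, t)) ⁻¹' {q : V × ℝ | q.1 + q.2 • w ∈ N}
        = (fun v => v + t • w) ⁻¹' N := rfl
    simp only [this, measure_preimage_add_right, hN0, Pi.zero_apply]
  have h1 := Measure.ae_ae_of_ae_prod (measure_eq_zero_iff_ae_notMem.1 h0)
  filter_upwards [h1] with v hv
  filter_upwards [hv] with t ht
  by_contra hc
  exact ht (hN hc)

/-- The segment from x to y may itself lie in the exceptional set. Almost every parallel translate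
meets that set in a null set, and on it the fundamental theorem of calculus gives the bound. Such
translates are dense, so continuity of f concludes. -/
theorem abs_sub_le_of_ae_norm_fderiv_le {f : V → ℝ} {K : ℝ} {C : ℝ≥0} {s : Set V}
    (hs : IsOpen s) (hc : Convex ℝ s) (hf : LipschitzOnWith C f s)
    (h : ∀ᵐ x ∂μ, x ∈ s → ∃ f' : V →L[ℝ] ℝ, HasFDerivAt f f' x ∧ ‖f'‖ ≤ K)
    {x y : V} (hx : x ∈ s) (hy : y ∈ s) : |f y - f x| ≤ K * ‖y - x‖ := by
  have hae := ae_ae_add_smul h (y - x)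
  have hfx : ContinuousAt f x := hf.continuousOn.continuousAt (hs.mem_nhds hx)
  have hfy : ContinuousAt f y := hf.continuousOn.continuousAt (hs.mem_nhds hy)
  have hty : Tendsto (fun v : V => v + (y - x)) (𝓝 x) (𝓝 y) := by
    have : Continuous fun v : V => v + (y - x) := by fun_prop
    simpa using this.tendsto x
  have hlim : Tendsto (fun v => |f (v + (y - x)) - f v|) (𝓝 x) (𝓝 |f y - f x|) :=
    ((hfy.tendsto.comp hty).sub hfx).abs
  have hfreq : ∃ᶠ v in 𝓝 x, |f (v + (y - x)) - f v| ≤ K * ‖y - x‖ := by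
    have hev : ∀ᶠ v in 𝓝 x, v ∈ s ∧ v + (y - x) ∈ s :=
      (hs.eventually_mem hx).and (hty.eventually (hs.eventually_mem hy))
    have hdense : ∃ᶠ v in 𝓝 x, ∀ᵐ t : ℝ, v + t • (y - x) ∈ s →
        ∃ f' : V →L[ℝ] ℝ, HasFDerivAt f f' (v + t • (y - x)) ∧ ‖f'‖ ≤ K :=
      mem_closure_iff_frequently.1 (Measure.dense_of_ae hae x)
    refine (hdense.and_eventually hev).mono ?_
    rintro v ⟨hv, hvs, hvs'⟩
    have hmem : ∀ t ∈ Icc (0 : ℝ) 1, v + t • (y - x) ∈ s := fun t ht => by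
      have := hc.add_smul_sub_mem hvs hvs' ht
      simpa using this
    have hlip : LipschitzOnWith (C * ‖y - x‖₊) (fun t : ℝ => f (v + t • (y - x))) (uIcc 0 1) := by
      refine hf.comp (f := fun t : ℝ => v + t • (y - x)) ?_ (by
        rw [uIcc_of_le zero_le_one]; exact hmem)
      refine LipschitzOnWith.of_dist_le_mul fun a _ b _ => ?_
      rw [dist_add_left, dist_eq_norm, ← sub_smul, norm_smul, mul_comm]
      rfl
    have := hlip.absolutelyContinuousOnInterval.abs_sub_le_of_ae_deriv_le (C := K * ‖y - x‖) ?_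
    · simpa using this
    · filter_upwards [hv] with t ht hmt
      rw [uIoc_of_le zero_le_one] at hmt
      obtain ⟨f', hf', hK⟩ := ht (hmem t ⟨hmt.1.le, hmt.2⟩)
      have hd : HasDerivAt (fun t : ℝ => v + t • (y - x)) (y - x) t := by
        simpa using ((hasDerivAt_id t).smul_const (y - x)).const_add v
      have hfd : HasDerivAt (fun t : ℝ => f (v + t • (y - x))) (f' (y - x)) t :=
        hf'.comp_hasDerivAt t hd
      rw [hfd.deriv]
      exact (f'.le_opNorm _).trans (by gcongr)
  exact le_of_tendsto_of_frequently hlim hfreq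

/-- Testing against continuous functionals reduces this to real-valued functions with no loss in the
constant. -/
theorem norm_sub_le_of_ae_norm_fderiv_le {W : Type*} [NormedAddCommGroup W] [NormedSpace ℝ W]
    {f : V → W} {K : ℝ} {C : ℝ≥0} {s : Set V} (hK0 : 0 ≤ K)
    (hs : IsOpen s) (hc : Convex ℝ s) (hf : LipschitzOnWith C f s)
    (h : ∀ᵐ x ∂μ, x ∈ s → ∃ f' : V →L[ℝ] W, HasFDerivAt f f' x ∧ ‖f'‖ ≤ K)
    {x y : V} (hx : x ∈ s) (hy : y ∈ s) : ‖f y - f x‖ ≤ K * ‖y - x‖ := by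
  refine NormedSpace.norm_le_dual_bound ℝ _ (by positivity) fun l => ?_
  have := abs_sub_le_of_ae_norm_fderiv_le (μ := μ) (f := fun z => l (f z)) (K := ‖l‖ * K) hs hc
    (l.lipschitz.comp_lipschitzOnWith hf) ?_ hx hy
  · rw [map_sub, Real.norm_eq_abs]
    linarith
  · filter_upwards [h] with z hz hzs
    obtain ⟨f', hf', hK⟩ := hz hzs
    exact ⟨l.comp f', l.hasFDerivAt.comp z hf', (l.opNorm_comp_le f').trans (by gcongr)⟩

/-- A locally Lipschitz function whose derivative is bounded by `K` almost everywhere near `x` has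
pointwise Lipschitz constant at most `K` at `x`. -/
theorem pointwiseLip_of_ae_norm_fderiv_le {W : Type*} [NormedAddCommGroup W] [NormedSpace ℝ W]
    {f : V → W} {K : ℝ} {C : ℝ≥0} {s : Set V} {x : V} (hK0 : 0 ≤ K) (hs : s ∈ 𝓝 x)
    (hf : LipschitzOnWith C f s)
    (h : ∀ᵐ z ∂μ, z ∈ s → ∃ f' : V →L[ℝ] W, HasFDerivAt f f' z ∧ ‖f'‖ ≤ K) :
    PointwiseLip f x K := by
  obtain ⟨r, hr, hrs⟩ := Metric.mem_nhds_iff.1 hs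
  intro k' hk'
  filter_upwards [Metric.ball_mem_nhds x hr] with y hy
  refine (norm_sub_le_of_ae_norm_fderiv_le (μ := μ) hK0 Metric.isOpen_ball (convex_ball x r)
    (hf.mono hrs) ?_ (Metric.mem_ball_self hr) hy).trans (by gcongr)
  filter_upwards [h] with z hz hzs using hz (hrs hzs)

theorem ae_differentiableAt_of_locallyLipschitzOn {W : Type*} [NormedAddCommGroup W]
    [NormedSpace ℝ W] [FiniteDimensional ℝ W] {f : V → W} {s : Set V} (hs : IsOpen s)
    (hf : LocallyLipschitzOn s f) : ∀ᵐ x ∂μ, x ∈ s → DifferentiableAt ℝ f x := by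
  rw [ae_iff]
  refine measure_null_of_locally_null _ fun x hx => ?_
  simp only [mem_ofPred_eq, Classical.not_imp] at hx
  obtain ⟨C, t, ht, hft⟩ := hf hx.1
  rw [hs.nhdsWithin_eq hx.1] at ht
  refine ⟨_, inter_mem_nhdsWithin _ (interior_mem_nhds.2 ht), ?_⟩
  have h1 := (hft.mono interior_subset).ae_differentiableWithinAt_of_mem (μ := μ)
  refine measure_mono_null ?_ (ae_iff.1 h1)
  rintro z ⟨hz1, hz2⟩ hc
  simp only [mem_ofPred_eq, Classical.not_imp] at hz1
  exact hz1.2 ((hc hz2).differentiableAt (isOpen_interior.mem_nhds hz2))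

end AEBound

end RadialStretch

namespace RadialStretch

/-! ### Singular values of the derivative of a radial stretching -/

/-- The larger singular value of the matrix with rows `(a, m)` and `(0, 1)`. -/
noncomputable def singMax (a m : ℝ) : ℝ :=
  (√((a + 1) ^ 2 + m ^ 2) + √((a - 1) ^ 2 + m ^ 2)) / 2

/-- The characteristic equation of AᵀA for the matrix A with rows (a, m) and (0, 1): trace a² + m² +
1, determinant a². -/
theorem singMax_sq (a m : ℝ) : (singMax a m ^ 2) ^ 2 - (a ^ 2 + m ^ 2 + 1) * singMax a m ^ 2 + a ^ 2
    = 0 := by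
  have h1 : √((a + 1) ^ 2 + m ^ 2) ^ 2 = (a + 1) ^ 2 + m ^ 2 := Real.sq_sqrt (by positivity)
  have h2 : √((a - 1) ^ 2 + m ^ 2) ^ 2 = (a - 1) ^ 2 + m ^ 2 := Real.sq_sqrt (by positivity)
  unfold singMax
  set P := √((a + 1) ^ 2 + m ^ 2)
  set Q := √((a - 1) ^ 2 + m ^ 2)
  have h3 : ((P + Q) / 2) ^ 2 = (a ^ 2 + m ^ 2 + 1 + P * Q) / 2 := by
    linear_combination h1 / 4 + h2 / 4
  rw [h3]
  linear_combination (Q ^ 2 / 4) * h1 + ((a + 1) ^ 2 + m ^ 2) / 4 * h2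

theorem le_singMax (a m : ℝ) : a ≤ singMax a m := by
  have h1 : a + 1 ≤ √((a + 1) ^ 2 + m ^ 2) := Real.le_sqrt_of_sq_le (by nlinarith)
  have h2 : a - 1 ≤ √((a - 1) ^ 2 + m ^ 2) := Real.le_sqrt_of_sq_le (by nlinarith)
  unfold singMax; linarith

theorem one_le_singMax (a m : ℝ) : 1 ≤ singMax a m := by
  have h1 : a + 1 ≤ √((a + 1) ^ 2 + m ^ 2) := Real.le_sqrt_of_sq_le (by nlinarith)
  have h2 : 1 - a ≤ √((a - 1) ^ 2 + m ^ 2) := Real.le_sqrt_of_sq_le (by nlinarith)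
  unfold singMax; linarith

theorem singMax_pos {a : ℝ} (ha : 0 < a) (m : ℝ) : 0 < singMax a m :=
  ha.trans_le (le_singMax a m)

/-- A crude growth bound, used to find some admissible slope m when only the existence of a constant
is assumed. -/
theorem half_le_singMax (a m : ℝ) : m / 2 ≤ singMax a m := by
  have h1 : m ≤ √((a + 1) ^ 2 + m ^ 2) := Real.le_sqrt_of_sq_le (by nlinarith [sq_nonneg (a + 1)])
  have h2 : 0 ≤ √((a - 1) ^ 2 + m ^ 2) := Real.sqrt_nonneg _
  unfold singMax; linarith

theorem singMax_strictMonoOn (a : ℝ) : StrictMonoOn (singMax a) (Ici 0) := fun x hx y hy h => by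
  have h0 : x ^ 2 < y ^ 2 := pow_lt_pow_left₀ h hx two_ne_zero
  have h1 : √((a + 1) ^ 2 + x ^ 2) < √((a + 1) ^ 2 + y ^ 2) :=
    Real.sqrt_lt_sqrt (by positivity) (by linarith)
  have h2 : √((a - 1) ^ 2 + x ^ 2) ≤ √((a - 1) ^ 2 + y ^ 2) := Real.sqrt_le_sqrt (by linarith)
  unfold singMax; linarith

theorem continuous_singMax (a : ℝ) : Continuous (singMax a) := by
  unfold singMax; fun_prop

/-- The inverse matrix has rows (1/a, -m/a) and (0, 1), and its larger singular value is the
reciprocal of the smaller one, a / `singMax a m`. -/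
theorem singMax_inv {a : ℝ} (ha : 0 < a) (m : ℝ) : singMax a⁻¹ (m / a) = singMax a m / a := by
  have key : ∀ b : ℝ, √((a⁻¹ + b) ^ 2 + (m / a) ^ 2) = √((a * b + 1) ^ 2 + m ^ 2) / a := fun b => by
    rw [← Real.sqrt_sq ha.le, ← Real.sqrt_div' _ (by positivity), Real.sqrt_sq ha.le]
    congr 1
    field_simp
    ring
  have h2 := key (-1)
  rw [← sub_eq_add_neg, show (a * -1 + 1) ^ 2 = (a - 1) ^ 2 by ring] at h2
  have h1 := key 1
  rw [mul_one] at h1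
  unfold singMax
  rw [h1, h2]
  ring

theorem sq_add_sq_le_singMax {a m p q γ : ℝ} (ha : 0 < a) (hm : 0 ≤ m)
    (hγ : |γ| ≤ m * p) : p ^ 2 + (a * q + γ) ^ 2 ≤ singMax a m ^ 2 * (p ^ 2 + q ^ 2) := by
  have hX := singMax_sq a m
  have hB : 0 ≤ singMax a m ^ 2 - a ^ 2 := by
    have := pow_le_pow_left₀ ha.le (le_singMax a m) 2
    linarith
  have h1 : 1 ≤ singMax a m ^ 2 := one_le_pow₀ (one_le_singMax a m)
  set X := singMax a m ^ 2
  -- By the characteristic equation the quadratic form X(p² + q²) - p² - (a|q| + mp)² has zero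
  -- discriminant, so it is a perfect square; this is `hexp` below.
  have hAB : (X - 1 - m ^ 2) * (X - a ^ 2) = (a * m) ^ 2 := by linear_combination hX
  have hA : 0 ≤ X - 1 - m ^ 2 := by
    rcases hB.eq_or_lt with h | h
    · have : a * m = 0 := by rw [← h, mul_zero] at hAB; exact pow_eq_zero_iff two_ne_zero |>.1 hAB.symm
      have : m = 0 := by simpa [ha.ne'] using this
      rw [this]; linarith
    · exact nonneg_of_mul_nonneg_left (hAB ▸ sq_nonneg _) h
  have hle : (a * q + γ) ^ 2 ≤ (a * |q| + m * p) ^ 2 := by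
    refine sq_le_sq' ?_ ?_
    · have := abs_le.1 hγ; have := neg_abs_le q; nlinarith
    · have := abs_le.1 hγ; have := le_abs_self q; nlinarith
  have hs : (√(X - 1 - m ^ 2) * √(X - a ^ 2)) = a * m := by
    rw [← Real.sqrt_mul hA, hAB, Real.sqrt_sq (by positivity)]
  have hs1 := Real.sq_sqrt hA
  have hs2 := Real.sq_sqrt hB
  have hsq := sq_nonneg (√(X - 1 - m ^ 2) * p - √(X - a ^ 2) * |q|)
  have hq := sq_abs q
  have hexp : (√(X - 1 - m ^ 2) * p - √(X - a ^ 2) * |q|) ^ 2 =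
      (X - 1 - m ^ 2) * p ^ 2 - 2 * (a * m) * p * |q| + (X - a ^ 2) * q ^ 2 := by
    rw [← hs, ← hq]
    linear_combination p ^ 2 * hs1 + |q| ^ 2 * hs2
  have : (a * |q| + m * p) ^ 2 = a ^ 2 * q ^ 2 + 2 * (a * m) * p * |q| + m ^ 2 * p ^ 2 := by
    rw [← hq]; ring
  linarith

section Stretching

variable {V : Type*} [NormedAddCommGroup V] [InnerProductSpace ℝ V]


theorem norm_sq_eq_of_unit {u : V} (hu : ‖u‖ = 1) (h : V) :
    ‖h‖ ^ 2 = ‖h - inner ℝ u h • u‖ ^ 2 + inner ℝ u h ^ 2 := by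
  rw [norm_sub_sq_real, norm_smul, hu, inner_smul_right, real_inner_comm u h, mul_one,
    Real.norm_eq_abs, sq_abs]
  ring

theorem norm_sq_add_smul_unit {u G : V} (hu : ‖u‖ = 1) (a : ℝ) (h : V) :
    ‖h + ((a - 1) * inner ℝ u h + inner ℝ G h) • u‖ ^ 2 =
      ‖h - inner ℝ u h • u‖ ^ 2 + (a * inner ℝ u h + inner ℝ G h) ^ 2 := by
  have huu : inner ℝ u u = 1 := by rw [real_inner_self_eq_norm_sq, hu, one_pow]
  rw [norm_sq_eq_of_unit hu (h + _)]
  have : inner ℝ u (h + ((a - 1) * inner ℝ u h + inner ℝ G h) • u) =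
      a * inner ℝ u h + inner ℝ G h := by
    rw [inner_add_right, inner_smul_right, huu]; ring
  rw [this]
  congr 3
  module

theorem abs_inner_le_of_orthogonal {u G : V} (hG : inner ℝ G u = 0) (h : V) :
    |inner ℝ G h| ≤ ‖G‖ * ‖h - inner ℝ u h • u‖ := by
  have : inner ℝ G h = inner ℝ G (h - inner ℝ u h • u) := by
    rw [inner_sub_right, inner_smul_right, hG]; ring
  rw [this]
  exact abs_real_inner_le_norm _ _

theorem norm_add_smul_unit_le {u G : V} (hu : ‖u‖ = 1) (hG : inner ℝ G u = 0) {a : ℝ} (ha : 0 < a)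
    (h : V) : ‖h + ((a - 1) * inner ℝ u h + inner ℝ G h) • u‖ ≤ singMax a ‖G‖ * ‖h‖ := by
  refine abs_le_of_sq_le_sq' ?_ (mul_nonneg (singMax_pos ha _).le (norm_nonneg _)) |>.2
  rw [norm_sq_add_smul_unit hu, mul_pow, norm_sq_eq_of_unit hu h]
  exact sq_add_sq_le_singMax ha (norm_nonneg _) (abs_inner_le_of_orthogonal hG h)

/-- The inverse map has the same form with a⁻¹ and -G/a, so the upper bound for it, together with
`singMax_inv`, yields this lower bound. -/
theorem le_norm_add_smul_unit {u G : V} (hu : ‖u‖ = 1) (hG : inner ℝ G u = 0) {a : ℝ} (ha : 0 < a)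
    (h : V) : a / singMax a ‖G‖ * ‖h‖ ≤ ‖h + ((a - 1) * inner ℝ u h + inner ℝ G h) • u‖ := by
  have hs := singMax_pos ha ‖G‖
  rw [div_mul_eq_mul_div, div_le_iff₀ hs, ← le_div_iff₀' ha]
  refine abs_le_of_sq_le_sq' ?_ (by positivity) |>.2
  rw [div_pow, mul_pow, norm_sq_add_smul_unit hu, norm_sq_eq_of_unit hu h]
  have hγ : |-(inner ℝ G h / a)| ≤ ‖G‖ / a * ‖h - inner ℝ u h • u‖ := by
    rw [abs_neg, abs_div, abs_of_pos ha, div_mul_eq_mul_div]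
    gcongr
    exact abs_inner_le_of_orthogonal hG h
  have := sq_add_sq_le_singMax (a := a⁻¹) (q := a * inner ℝ u h + inner ℝ G h) (inv_pos.2 ha)
    (by positivity) hγ
  rw [singMax_inv ha] at this
  calc _ = ‖h - inner ℝ u h • u‖ ^ 2 +
        (a⁻¹ * (a * inner ℝ u h + inner ℝ G h) + -(inner ℝ G h / a)) ^ 2 := by
        field_simp; ring
    _ ≤ _ := this
    _ = _ := by ring

/-- Both roots of the characteristic equation are attained, so one lemma serves the maximal and the
minimal stretch. For G ≠ 0 the vector is an eigenvector in the plane of u and G. For G = 0 the roots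
are 1 and a², attained at w ⟂ u and at u. -/
theorem exists_norm_sq_eq {u G w : V} (hu : ‖u‖ = 1) (hG : inner ℝ G u = 0) (hw : w ≠ 0)
    (huw : inner ℝ u w = 0) {a : ℝ} (ha : 0 < a) {X : ℝ}
    (hX : X ^ 2 - (a ^ 2 + ‖G‖ ^ 2 + 1) * X + a ^ 2 = 0) :
    ∃ h : V, h ≠ 0 ∧ ‖h + ((a - 1) * inner ℝ u h + inner ℝ G h) • u‖ ^ 2 = X * ‖h‖ ^ 2 := by
  have huu : inner ℝ u u = 1 := by rw [real_inner_self_eq_norm_sq, hu, one_pow]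
  have hGu : inner ℝ u G = 0 := by rw [real_inner_comm, hG]
  rcases eq_or_ne G 0 with rfl | hG0
  · have : (X - 1) * (X - a ^ 2) = 0 := by simp at hX; linear_combination hX
    rcases mul_eq_zero.1 this with h | h
    · exact ⟨w, hw, by simp [huw, sub_eq_zero.1 h]⟩
    · refine ⟨u, fun h0 => by simp [h0] at hu, ?_⟩
      rw [norm_sq_add_smul_unit hu]
      simp [hu, sub_eq_zero.1 h]
  · refine ⟨(X - 1 - ‖G‖ ^ 2) • u + a • G, fun h0 => ?_, ?_⟩
    · have : inner ℝ G ((X - 1 - ‖G‖ ^ 2) • u + a • G) = 0 := by rw [h0, inner_zero_right]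
      rw [inner_add_right, inner_smul_right, inner_smul_right, hG, real_inner_self_eq_norm_sq] at this
      simp [ha.ne', hG0] at this
    · rw [norm_sq_add_smul_unit hu, norm_sq_eq_of_unit hu (_ + _)]
      have h1 : inner ℝ u ((X - 1 - ‖G‖ ^ 2) • u + a • G) = X - 1 - ‖G‖ ^ 2 := by
        rw [inner_add_right, inner_smul_right, inner_smul_right, huu, hGu]; ring
      have h2 : inner ℝ G ((X - 1 - ‖G‖ ^ 2) • u + a • G) = a * ‖G‖ ^ 2 := by
        rw [inner_add_right, inner_smul_right, inner_smul_right, hG, real_inner_self_eq_norm_sq]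
        ring
      rw [h1, h2, add_sub_cancel_left, norm_smul, mul_pow, Real.norm_eq_abs, sq_abs]
      linear_combination (-(X - 1 - ‖G‖ ^ 2)) * hX

end Stretching

theorem exists_ne_zero_inner_eq_zero {n : ℕ} (hn : 2 ≤ n) (u : E n) :
    ∃ w : E n, w ≠ 0 ∧ inner ℝ u w = 0 := by
  have h := LinearMap.ker_ne_bot_of_finrank_lt (f := (innerSL ℝ u).toLinearMap) (by simp; omega)
  obtain ⟨w, hw, hw0⟩ := Submodule.exists_mem_ne_zero_of_ne_bot h
  exact ⟨w, hw0, by simpa using hw⟩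

variable {n : ℕ} {u G : E n} {a c : ℝ} {T : E n →L[ℝ] E n}

theorem opNorm_stretching (hn : 2 ≤ n) (hu : ‖u‖ = 1) (hG : inner ℝ G u = 0) (ha : 0 < a)
    (hc : 0 < c)
    (hT : ∀ h, T h = c • (h + ((a - 1) * inner ℝ u h + inner ℝ G h) • u)) :
    ‖T‖ = c * singMax a ‖G‖ := by
  have hs := singMax_pos ha ‖G‖
  refine le_antisymm (T.opNorm_le_bound (by positivity) fun h => ?_) ?_
  · rw [hT, norm_smul, Real.norm_of_nonneg hc.le, mul_assoc]
    gcongr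
    exact norm_add_smul_unit_le hu hG ha h
  · obtain ⟨w, hw, huw⟩ := exists_ne_zero_inner_eq_zero hn u
    obtain ⟨h, hh, hX⟩ := exists_norm_sq_eq hu hG hw huw ha (singMax_sq a ‖G‖)
    have h1 := T.le_opNorm h
    rw [hT, norm_smul, Real.norm_of_nonneg hc.le] at h1
    rw [← mul_pow, sq_eq_sq₀ (norm_nonneg _) (by positivity)] at hX
    rw [hX, ← mul_assoc] at h1
    exact le_of_mul_le_mul_right h1 (norm_pos_iff.2 hh)

theorem iInf_norm_stretching (hn : 2 ≤ n) (hu : ‖u‖ = 1) (hG : inner ℝ G u = 0) (ha : 0 < a)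
    (hc : 0 < c)
    (hT : ∀ h, T h = c • (h + ((a - 1) * inner ℝ u h + inner ℝ G h) • u)) :
    ⨅ h : Metric.sphere (0 : E n) 1, ‖T h‖ = c * (a / singMax a ‖G‖) := by
  have hs := singMax_pos ha ‖G‖
  have : Nonempty (Metric.sphere (0 : E n) 1) := ⟨⟨u, by simpa using hu⟩⟩
  refine le_antisymm ?_ (le_ciInf fun h => ?_)
  · obtain ⟨w, hw, huw⟩ := exists_ne_zero_inner_eq_zero hn u
    have hX : ((a / singMax a ‖G‖) ^ 2) ^ 2 -
        (a ^ 2 + ‖G‖ ^ 2 + 1) * (a / singMax a ‖G‖) ^ 2 + a ^ 2 = 0 := by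
      have := singMax_sq a ‖G‖
      field_simp
      linear_combination a ^ 2 * this
    obtain ⟨h, hh, hX⟩ := exists_norm_sq_eq hu hG hw huw ha hX
    have hh' := norm_pos_iff.2 hh
    have hb : BddBelow (range fun h : Metric.sphere (0 : E n) 1 => ‖T h‖) :=
      ⟨0, by rintro _ ⟨h, rfl⟩; exact norm_nonneg _⟩
    refine (ciInf_le hb ⟨‖h‖⁻¹ • h, by simp [norm_smul, hh]⟩).trans ?_
    rw [← mul_pow, sq_eq_sq₀ (norm_nonneg _) (by positivity)] at hX
    rw [map_smul, norm_smul, hT, norm_smul, Real.norm_of_nonneg hc.le, hX, norm_inv, norm_norm]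
    apply le_of_eq
    field_simp
  · have hh : ‖(h : E n)‖ = 1 := by simp
    rw [hT, norm_smul, Real.norm_of_nonneg hc.le]
    gcongr
    simpa only [hh, mul_one] using le_norm_add_smul_unit hu hG ha (h : E n)

/-- T is c times a rank-one perturbation h ↦ h + f(h)u of the identity, whose determinant is 1 +
f(u) = 1 + (a - 1). -/
theorem det_stretching (hu : ‖u‖ = 1) (hG : inner ℝ G u = 0)
    (hT : ∀ h, T h = c • (h + ((a - 1) * inner ℝ u h + inner ℝ G h) • u)) :
    T.det = c ^ n * a := by
  have : (T : E n →ₗ[ℝ] E n) = c • LinearMap.transvection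
      (((a - 1) • innerSL ℝ u + innerSL ℝ G : E n →L[ℝ] ℝ) : E n →ₗ[ℝ] ℝ) u := by
    ext1 h
    simp [hT, LinearMap.transvection.apply]
  rw [ContinuousLinearMap.det, this, LinearMap.det_smul, LinearMap.transvection.det]
  simp [hu, hG]

end RadialStretch

namespace RadialStretch

/-! ### Local Lipschitz continuity -/

section LocallyLipschitz

variable {V W Z : Type*} [NormedAddCommGroup V] [NormedAddCommGroup W] [NormedAddCommGroup Z]

theorem _root_.LocallyLipschitzOn.prodMk_id {f : V → W} {s : Set V} (hf : LocallyLipschitzOn s f) :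
    LocallyLipschitzOn s (fun x => (f x, x)) := fun x hx => by
  obtain ⟨C, t, ht, hft⟩ := hf hx
  exact ⟨_, t, ht, hft.prodMk LipschitzWith.id.lipschitzOnWith⟩

variable [NormedSpace ℝ W]

theorem _root_.LocallyLipschitzOn.contDiffAt_comp [NormedSpace ℝ Z] {f : V → W} {g : W → Z} {s : Set V}
    (hf : LocallyLipschitzOn s f) (hg : ∀ x ∈ s, ContDiffAt ℝ 1 g (f x)) :
    LocallyLipschitzOn s (fun x => g (f x)) := fun x hx => by
  obtain ⟨K, t, ht, hgt⟩ := (hg x hx).exists_lipschitzOnWith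
  obtain ⟨C, t', ht', hft⟩ := hf hx
  have := hf.continuousOn x hx ht
  exact ⟨K * C, t' ∩ f ⁻¹' t, inter_mem ht' this,
    hgt.comp (hft.mono inter_subset_left) fun z hz => hz.2⟩

theorem locallyLipschitzOn_of_contDiffAt [NormedSpace ℝ V] {f : V → W} {s : Set V}
    (hf : ∀ x ∈ s, ContDiffAt ℝ 1 f x) : LocallyLipschitzOn s f :=
  (LipschitzWith.id.locallyLipschitz.locallyLipschitzOn (s := s)).contDiffAt_comp hf

end LocallyLipschitz

/-! ### Radial stretchings -/

variable {n : ℕ}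

/-- The map `x ↦ |x|ᵃ⁻¹ e^{ψ(x)} x`. -/
noncomputable def stretch (a : ℝ) (ψ : E n → ℝ) (x : E n) : E n :=
  Real.exp ((a - 1) * Real.log ‖x‖ + ψ x) • x

/-- A function that is homogeneous of degree `0` and continuous away from the origin. -/
structure IsAngular (ψ : E n → ℝ) : Prop where
  smul : ∀ (x : E n) (t : ℝ), 0 < t → ψ (t • x) = ψ x
  continuousOn : ContinuousOn ψ {0}ᶜ

theorem IsAngular.neg {ψ : E n → ℝ} (h : IsAngular ψ) : IsAngular (fun x => -ψ x) :=
  ⟨fun x t ht => by rw [h.smul x t ht], h.continuousOn.neg⟩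

theorem IsAngular.continuousAt {ψ : E n → ℝ} (h : IsAngular ψ) {x : E n} (hx : x ≠ 0) :
    ContinuousAt ψ x :=
  h.continuousOn.continuousAt (isOpen_compl_singleton.mem_nhds hx)

theorem IsAngular.exists_bound {ψ : E n → ℝ} (h : IsAngular ψ) : ∃ B, ∀ x, x ≠ 0 → |ψ x| ≤ B := by
  obtain ⟨B, hB⟩ := (isCompact_sphere (0 : E n) 1).exists_bound_of_continuousOn
    (h.continuousOn.mono fun x hx h0 => by simp [mem_singleton_iff.1 h0] at hx)
  refine ⟨B, fun x hx => ?_⟩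
  have := hB (‖x‖⁻¹ • x) (by simp [norm_smul, hx])
  rwa [h.smul _ _ (inv_pos.2 (norm_pos_iff.2 hx))] at this

theorem stretch_zero (a : ℝ) (ψ : E n → ℝ) : stretch a ψ 0 = 0 := smul_zero _

theorem norm_stretch (a : ℝ) (ψ : E n → ℝ) {x : E n} (hx : x ≠ 0) :
    ‖stretch a ψ x‖ = Real.exp (a * Real.log ‖x‖ + ψ x) := by
  rw [stretch, norm_smul, Real.norm_of_nonneg (Real.exp_pos _).le]
  nth_rw 2 [← Real.exp_log (norm_pos_iff.2 hx)]
  rw [← Real.exp_add]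
  ring_nf

theorem log_norm_stretch (a : ℝ) (ψ : E n → ℝ) {x : E n} (hx : x ≠ 0) :
    Real.log ‖stretch a ψ x‖ = a * Real.log ‖x‖ + ψ x := by
  rw [norm_stretch a ψ hx, Real.log_exp]

theorem stretch_one (ψ : E n → ℝ) (x : E n) : stretch 1 ψ x = Real.exp (ψ x) • x := by
  simp [stretch]

theorem stretch_ne_zero (a : ℝ) (ψ : E n → ℝ) {x : E n} (hx : x ≠ 0) : stretch a ψ x ≠ 0 :=
  smul_ne_zero (Real.exp_pos _).ne' hx

/-- In logarithmic polar coordinates the map is (s, u) ↦ (as + ψ(u), u), which is inverted ray by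
ray. -/
theorem stretch_inv_stretch {a : ℝ} (ha : 0 < a) {ψ : E n → ℝ} (h : IsAngular ψ) (x : E n) :
    stretch a⁻¹ (fun y => -(a⁻¹ * ψ y)) (stretch a ψ x) = x := by
  rcases eq_or_ne x 0 with rfl | hx
  · simp [stretch_zero]
  rw [stretch, log_norm_stretch a ψ hx, stretch, h.smul _ _ (Real.exp_pos _), smul_smul,
    ← Real.exp_add]
  convert one_smul ℝ x
  refine Real.exp_eq_one_iff _ |>.2 ?_
  field_simp
  ring

theorem continuous_stretch {a : ℝ} (ha : 0 < a) {ψ : E n → ℝ} (h : IsAngular ψ) :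
    Continuous (stretch a ψ) := by
  rw [continuous_iff_continuousAt]
  intro x
  rcases eq_or_ne x 0 with rfl | hx
  · obtain ⟨B, hB⟩ := h.exists_bound
    rw [ContinuousAt, stretch_zero, tendsto_zero_iff_norm_tendsto_zero]
    have hlim : Tendsto (fun x : E n => ‖x‖ ^ a * Real.exp B) (𝓝 0) (𝓝 0) := by
      have : ContinuousAt (fun x : E n => ‖x‖ ^ a * Real.exp B) 0 :=
        (continuous_norm.continuousAt.rpow_const (Or.inr ha.le)).mul continuousAt_const
      simpa [ContinuousAt, Real.zero_rpow ha.ne'] using this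
    refine squeeze_zero (fun _ => norm_nonneg _) (fun x => ?_) hlim
    rcases eq_or_ne x 0 with rfl | hx
    · rw [stretch_zero, norm_zero]; positivity
    · rw [norm_stretch a ψ hx, Real.rpow_def_of_pos (norm_pos_iff.2 hx), ← Real.exp_add]
      refine Real.exp_le_exp.2 ?_
      have := (abs_le.1 (hB x hx)).2
      linarith
  · have h1 : ContinuousAt (fun x : E n => Real.log ‖x‖) x :=
      continuous_norm.continuousAt.log (norm_ne_zero_iff.2 hx)
    exact (((continuousAt_const.mul h1).add (h.continuousAt hx)).rexp).smul continuousAt_id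

theorem IsAngular.inverse {ψ : E n → ℝ} (h : IsAngular ψ) (a : ℝ) :
    IsAngular (fun y => -(a⁻¹ * ψ y)) :=
  ⟨fun x t ht => by rw [h.smul x t ht], (continuousOn_const.mul h.continuousOn).neg⟩

/-- A radial stretching as a homeomorphism. -/
noncomputable def stretchHomeomorph {a : ℝ} (ha : 0 < a) {ψ : E n → ℝ} (h : IsAngular ψ) :
    E n ≃ₜ E n where
  toFun := stretch a ψ
  invFun := stretch a⁻¹ (fun y => -(a⁻¹ * ψ y))
  left_inv := stretch_inv_stretch ha h
  right_inv x := by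
    have := stretch_inv_stretch (inv_pos.2 ha) (h.inverse a) x
    simpa [ha.ne'] using this
  continuous_toFun := continuous_stretch ha h
  continuous_invFun := continuous_stretch (inv_pos.2 ha) (h.inverse a)

/-! ### Derivative of a radial stretching -/

theorem contDiffAt_log_norm {x : E n} (hx : x ≠ 0) :
    ContDiffAt ℝ 1 (fun x : E n => Real.log ‖x‖) x :=
  (contDiffAt_norm ℝ hx).log (norm_ne_zero_iff.2 hx)

theorem hasFDerivAt_log_norm {x : E n} (hx : x ≠ 0) :
    HasFDerivAt (fun x : E n => Real.log ‖x‖) ((‖x‖ ^ 2)⁻¹ • innerSL ℝ x) x := by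
  have h1 := ((hasStrictFDerivAt_norm_sq x).hasFDerivAt.log
    (pow_ne_zero 2 (norm_ne_zero_iff.2 hx))).const_mul (1 / 2 : ℝ)
  refine (h1.congr_of_eventuallyEq (Eventually.of_forall fun y => ?_)).congr_fderiv ?_
  · simp only [Real.log_pow]; push_cast; ring
  · ext h; simp; ring

/-- The derivative of a radial stretching. -/
theorem exists_hasFDerivAt_stretch (a : ℝ) {ψ : E n → ℝ} (hψ : IsAngular ψ) {x : E n} (hx : x ≠ 0)
    {ψ' : E n →L[ℝ] ℝ} (h : HasFDerivAt ψ ψ' x) :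
    ∃ (G : E n) (T : E n →L[ℝ] E n), HasFDerivAt (stretch a ψ) T x ∧
      inner ℝ G (‖x‖⁻¹ • x) = 0 ∧ ‖G‖ = ‖x‖ * ‖ψ'‖ ∧
      ∀ v, T v = Real.exp ((a - 1) * Real.log ‖x‖ + ψ x) •
        (v + ((a - 1) * inner ℝ (‖x‖⁻¹ • x) v + inner ℝ G v) • (‖x‖⁻¹ • x)) := by
  have hx' := norm_pos_iff.2 hx
  -- Euler's relation in degree 0: ψ is constant along the ray through x. This is what makes G
  -- orthogonal to u.
  have hψx : ψ' x = 0 := by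
    have h1 : HasDerivAt (fun t : ℝ => x + t • x) x 0 := by
      simpa using ((hasDerivAt_id (0 : ℝ)).smul_const x).const_add x
    have h0 : HasFDerivAt ψ ψ' (x + (0 : ℝ) • x) := by simpa using h
    have h2 : HasDerivAt (fun t : ℝ => ψ (x + t • x)) (ψ' x) 0 := h0.comp_hasDerivAt 0 h1
    have h3 : (fun t : ℝ => ψ (x + t • x)) =ᶠ[𝓝 0] fun _ => ψ x := by
      filter_upwards [lt_mem_nhds (show (-1 : ℝ) < 0 by norm_num)] with t ht
      rw [← hψ.smul x (1 + t) (by linarith), add_smul, one_smul]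
    exact h2.unique ((hasDerivAt_const (0 : ℝ) (ψ x)).congr_of_eventuallyEq h3)
  set g := (InnerProductSpace.toDual ℝ (E n)).symm ψ' with hg
  have hgv : ∀ v, inner ℝ g v = ψ' v := fun v => InnerProductSpace.toDual_symm_apply
  have hexp := (((hasFDerivAt_log_norm hx).const_mul (a - 1)).add h).exp
  refine ⟨‖x‖ • g, _, hexp.smul (hasFDerivAt_id x), ?_, ?_, fun v => ?_⟩
  · rw [inner_smul_left, inner_smul_right, hgv, hψx]; simp
  · rw [norm_smul, norm_norm, hg, LinearIsometryEquiv.norm_map]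
  · simp only [inner_smul_left, hgv, add_apply, smul_apply,
      ContinuousLinearMap.smulRight_apply, ContinuousLinearMap.id_apply, innerSL_apply_apply,
      smul_eq_mul, conj_trivial, smul_add, smul_smul, Pi.add_apply]
    congr 2
    field_simp

/-- The angular part is recovered as ψ = log‖stretch a ψ‖ - a log‖·‖, so regularity passes back from
the stretching to ψ. -/
theorem hasFDerivAt_angular {a : ℝ} {ψ : E n → ℝ} {x : E n} (hx : x ≠ 0)
    (h : DifferentiableAt ℝ (stretch a ψ) x) : DifferentiableAt ℝ ψ x := by
  have h1 : DifferentiableAt ℝ (fun y => Real.log ‖stretch a ψ y‖ - a * Real.log ‖y‖) x :=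
    ((h.norm ℝ (stretch_ne_zero a ψ hx)).log (norm_ne_zero_iff.2 (stretch_ne_zero a ψ hx))).sub
      ((hasFDerivAt_log_norm hx).differentiableAt.const_mul a)
  refine h1.congr_of_eventuallyEq ?_
  filter_upwards [isOpen_compl_singleton.mem_nhds hx] with y hy
  rw [log_norm_stretch a ψ hy]; ring

/-! ### Lipschitz bounds of a stretching and of its angular part -/

theorem locallyLipschitzOn_stretch {ψ : E n → ℝ} (a : ℝ) (h : LocallyLipschitzOn {0}ᶜ ψ) :
    LocallyLipschitzOn {0}ᶜ (stretch a ψ) := by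
  have h1 : LocallyLipschitzOn {0}ᶜ fun x : E n => (a - 1) * Real.log ‖x‖ :=
    locallyLipschitzOn_of_contDiffAt fun x hx => contDiffAt_const.mul (contDiffAt_log_norm hx)
  exact (h1.add h).prodMk_id.contDiffAt_comp (g := fun p : ℝ × E n => Real.exp p.1 • p.2)
    fun x _ => (contDiff_fst.exp.smul contDiff_snd).contDiffAt

theorem locallyLipschitzOn_angular {ψ : E n → ℝ} {a : ℝ}
    (h : LocallyLipschitzOn {0}ᶜ (stretch a ψ)) : LocallyLipschitzOn {0}ᶜ ψ := by
  have h1 : LocallyLipschitzOn {0}ᶜ fun x : E n => a * Real.log ‖x‖ :=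
    locallyLipschitzOn_of_contDiffAt fun x hx => contDiffAt_const.mul (contDiffAt_log_norm hx)
  have h2 := h.contDiffAt_comp (g := fun x : E n => Real.log ‖x‖)
    fun x hx => contDiffAt_log_norm (stretch_ne_zero a ψ hx)
  intro x hx
  obtain ⟨K, t, ht, hK⟩ := (h2.sub h1) hx
  refine ⟨K, t ∩ {0}ᶜ, inter_mem ht self_mem_nhdsWithin, fun y hy z hz => ?_⟩
  have := hK hy.1 hz.1
  simpa only [log_norm_stretch a ψ hy.2, log_norm_stretch a ψ hz.2, add_sub_cancel_left] using this

theorem locallyLipschitzOn_of_pointwiseLip {ψ : E n → ℝ} {m : ℝ} (hm : 0 ≤ m)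
    (h : ∀ x, x ≠ 0 → PointwiseLip ψ x (m / ‖x‖)) : LocallyLipschitzOn {0}ᶜ ψ := fun x hx => by
  have hx' := norm_pos_iff.2 hx
  -- On this convex ball |z| ≥ |x|/2, so m/|z| is bounded uniformly.
  refine ⟨_, Metric.ball x (‖x‖ / 2), mem_nhdsWithin_of_mem_nhds
    (Metric.ball_mem_nhds x (by positivity)),
    lipschitzOnWith_of_pointwiseLip (k := m / (‖x‖ / 2)) (convex_ball _ _) fun z hz => ?_⟩
  have hz' : ‖x‖ / 2 ≤ ‖z‖ := by
    have h1 := norm_sub_norm_le x z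
    rw [Metric.mem_ball, dist_comm, dist_eq_norm] at hz
    linarith
  refine (h z (norm_pos_iff.1 (by linarith))).mono ?_
  gcongr

/-- Near x the gradient bound m/|z| is below any given k > m/|x|, so the Fubini argument on a small
ball gives every such k. -/
theorem pointwiseLip_of_ae {ψ : E n → ℝ} (hψ : LocallyLipschitzOn {0}ᶜ ψ) {m : ℝ}
    (hm : 0 ≤ m) {x : E n} (hx : x ≠ 0) {s : Set (E n)} (hs : s ∈ 𝓝 x)
    (h : ∀ᵐ z : E n, z ∈ s → ∀ ψ' : E n →L[ℝ] ℝ, HasFDerivAt ψ ψ' z → ‖z‖ * ‖ψ'‖ ≤ m) :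
    PointwiseLip ψ x (m / ‖x‖) := by
  refine pointwiseLip_of_forall_gt fun k hk => ?_
  have hk0 : 0 ≤ k := le_trans (by positivity) hk.le
  obtain ⟨C, t, ht, hC⟩ := hψ hx
  rw [isOpen_compl_singleton.nhdsWithin_eq hx] at ht
  have h1 : ∀ᶠ z in 𝓝 x, m / ‖z‖ < k :=
    (continuousAt_const.div continuous_norm.continuousAt
      (norm_ne_zero_iff.2 hx)).eventually (gt_mem_nhds hk)
  have h2 : {0}ᶜ ∈ 𝓝 x := isOpen_compl_singleton.mem_nhds hx
  refine pointwiseLip_of_ae_norm_fderiv_le (μ := volume) hk0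
    (inter_mem (inter_mem ht hs) (inter_mem h1 h2))
    (hC.mono fun z hz => hz.1.1) ?_
  filter_upwards [h, ae_differentiableAt_of_locallyLipschitzOn (μ := volume)
    isOpen_compl_singleton hψ] with z hz hzd hzs
  have hz0 : z ≠ 0 := hzs.2.2
  have hd := (hzd hz0).hasFDerivAt
  refine ⟨_, hd, ?_⟩
  have h3 := hz hzs.1.2 _ hd
  rw [mul_comm, ← le_div_iff₀ (norm_pos_iff.2 hz0)] at h3
  exact h3.trans (le_of_lt hzs.2.1)

/-- An upper bound for the Lipschitz constant of `x ↦ e^{ψ(x)} x`. -/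
theorem lipschitzWith_stretch_one (hn : 2 ≤ n) {ψ : E n → ℝ} (hψ : IsAngular ψ) {m₀ K : ℝ}
    (hm₀ : 0 ≤ m₀) (h₀ : ∀ x, x ≠ 0 → PointwiseLip ψ x (m₀ / ‖x‖))
    (h : ∀ x, x ≠ 0 → ∃ m, 0 ≤ m ∧ PointwiseLip ψ x (m / ‖x‖) ∧
      Real.exp (ψ x) * singMax 1 m ≤ K) (hK : 0 ≤ K) : LipschitzWith K.toNNReal (stretch 1 ψ) := by
  -- The uniform slope m₀ only secures local Lipschitz continuity, hence differentiability almost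
  -- everywhere; the value K comes from the slopes m in `h`.
  have hloc := locallyLipschitzOn_of_pointwiseLip hm₀ h₀
  rw [← lipschitzOnWith_univ]
  refine lipschitzOnWith_of_pointwiseLip convex_univ fun x _ => ?_
  rcases eq_or_ne x 0 with rfl | hx
  -- At the origin no derivative is needed: |f(y)| = e^ψ(y)|y|, and e^ψ(y) ≤ K because `singMax` is
  -- at least 1.
  · intro k hk
    refine Eventually.of_forall fun y => ?_
    rw [stretch_zero, sub_zero, sub_zero]
    rcases eq_or_ne y 0 with rfl | hy
    · simp [stretch_zero]
    · obtain ⟨m, -, -, hmK⟩ := h y hy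
      rw [stretch_one, norm_smul, Real.norm_of_nonneg (Real.exp_pos _).le]
      refine mul_le_mul_of_nonneg_right ?_ (norm_nonneg y)
      have := le_mul_of_one_le_right (Real.exp_pos (ψ y)).le (one_le_singMax 1 m)
      linarith
  · obtain ⟨C, t, ht, hC⟩ := locallyLipschitzOn_stretch 1 hloc hx
    rw [isOpen_compl_singleton.nhdsWithin_eq hx] at ht
    refine pointwiseLip_of_ae_norm_fderiv_le (μ := volume) hK
      (inter_mem ht (isOpen_compl_singleton.mem_nhds hx)) (hC.mono inter_subset_left) ?_
    filter_upwards [ae_differentiableAt_of_locallyLipschitzOn (μ := volume)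
      isOpen_compl_singleton hloc] with z hzd hz
    have hz0 : z ≠ 0 := hz.2
    have hz' := norm_pos_iff.2 hz0
    have hd := (hzd hz0).hasFDerivAt
    obtain ⟨G, T, hT, hG, hGn, hTv⟩ := exists_hasFDerivAt_stretch 1 hψ hz0 hd
    refine ⟨T, hT, ?_⟩
    rw [opNorm_stretching hn (by simp [norm_smul, hz0]) hG one_pos (Real.exp_pos _) hTv]
    obtain ⟨m, hm, hpm, hmK⟩ := h z hz0
    simp only [sub_self, zero_mul, zero_add]
    refine le_trans ?_ hmK
    gcongr
    refine (singMax_strictMonoOn 1).monotoneOn (norm_nonneg G) hm ?_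
    rw [hGn, mul_comm, ← le_div_iff₀ hz']
    exact hpm.norm_fderiv_le (by positivity) hd

theorem exp_le_of_lipschitzWith {ψ : E n → ℝ} {K : ℝ≥0} (h : LipschitzWith K (stretch 1 ψ))
    {x : E n} (hx : x ≠ 0) : Real.exp (ψ x) ≤ K := by
  have := h.norm_sub_le x 0
  rw [stretch_zero, sub_zero, sub_zero, stretch_one, norm_smul,
    Real.norm_of_nonneg (Real.exp_pos _).le] at this
  exact le_of_mul_le_mul_right this (norm_pos_iff.2 hx)

/-- A Lipschitz bound for `x ↦ e^{ψ(x)} x` bounds the pointwise Lipschitz constants of `ψ`. -/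
theorem pointwiseLip_of_lipschitzWith (hn : 2 ≤ n) {ψ : E n → ℝ} (hψ : IsAngular ψ) {K : ℝ≥0}
    (h : LipschitzWith K (stretch 1 ψ)) {x : E n} (hx : x ≠ 0) {m : ℝ} (hm : 0 ≤ m)
    (hK : K < Real.exp (ψ x) * singMax 1 m) : PointwiseLip ψ x (m / ‖x‖) := by
  have hloc := locallyLipschitzOn_angular (h.locallyLipschitz.locallyLipschitzOn (s := {0}ᶜ))
  -- The strict inequality persists near x, where ‖G‖ > m would force the operator norm of the
  -- derivative above K.
  have h1 : ∀ᶠ z in 𝓝 x, K < Real.exp (ψ z) * singMax 1 m :=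
    ((hψ.continuousAt hx).rexp.mul continuousAt_const).eventually (lt_mem_nhds hK)
  refine pointwiseLip_of_ae hloc hm hx
    (inter_mem h1 (isOpen_compl_singleton.mem_nhds hx)) (Eventually.of_forall fun z hz ψ' hd => ?_)
  have hz0 : z ≠ 0 := hz.2
  have hz1 : K < Real.exp (ψ z) * singMax 1 m := hz.1
  obtain ⟨G, T, hT, hG, hGn, hTv⟩ := exists_hasFDerivAt_stretch 1 hψ hz0 hd
  have hle := hT.le_of_lipschitz h
  rw [opNorm_stretching hn (by simp [norm_smul, hz0]) hG one_pos (Real.exp_pos _) hTv] at hle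
  simp only [sub_self, zero_mul, zero_add] at hle
  rw [← hGn]
  by_contra! hlt
  have h2 := (singMax_strictMonoOn 1).monotoneOn hm (norm_nonneg G) hlt.le
  have h3 := mul_le_mul_of_nonneg_left h2 (Real.exp_pos (ψ z)).le
  linarith

end RadialStretch

namespace RadialStretch

variable {n : ℕ}

/-! ### Lines parallel to the coordinate axes -/

theorem measurePreserving_insertCoord (i : Fin n) :
    MeasurePreserving
      (fun p : ({j : Fin n // j ≠ i} → ℝ) × ℝ => insertCoord i p.2 p.1) := by
  let _ : Fintype {j : Fin n // j = i} := Subtype.fintype _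
  have h1 : MeasurePreserving (Prod.swap : ({j : Fin n // j ≠ i} → ℝ) × ℝ → _) volume volume :=
    Measure.measurePreserving_swap
  have h0 : MeasurePreserving (MeasurableEquiv.funUnique {j : Fin n // j = i} ℝ) volume volume := by
    convert! volume_preserving_funUnique {j : Fin n // j = i} ℝ
  have h2 : MeasurePreserving
      (Prod.map (MeasurableEquiv.funUnique {j : Fin n // j = i} ℝ).symm
        (id : ({j : Fin n // j ≠ i} → ℝ) → _)) volume volume :=
    (h0.symm _).prod (MeasurePreserving.id _)
  have h3 := (volume_preserving_piEquivPiSubtypeProd (fun _ : Fin n => ℝ) (· = i)).symm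
  have h4 := PiLp.volume_preserving_toLp (Fin n)
  have h := h4.comp (h3.comp (h2.comp h1))
  exact h

theorem ae_ae_insertCoord {p : E n → Prop} (hp : ∀ᵐ x, p x) (i : Fin n) :
    ∀ᵐ y : {j : Fin n // j ≠ i} → ℝ, ∀ᵐ t : ℝ, p (insertCoord i t y) :=
  Measure.ae_ae_of_ae_prod ((measurePreserving_insertCoord i).quasiMeasurePreserving.ae hp)

theorem insertCoord_eq (i : Fin n) (t : ℝ) (y : {j : Fin n // j ≠ i} → ℝ) :
    insertCoord i t y = insertCoord i 0 y + t • EuclideanSpace.single i (1 : ℝ) := by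
  ext j
  by_cases h : j = i
  · subst h; simp [insertCoord]
  · simp [insertCoord, h]

theorem hasDerivAt_insertCoord (i : Fin n) (y : {j : Fin n // j ≠ i} → ℝ) (t : ℝ) :
    HasDerivAt (fun t => insertCoord i t y) (EuclideanSpace.single i (1 : ℝ)) t := by
  rw [show (fun t => insertCoord i t y) = _ from funext fun t => insertCoord_eq i t y]
  simpa using ((hasDerivAt_id t).smul_const (EuclideanSpace.single i (1 : ℝ))).const_add
    (insertCoord i 0 y)

theorem locallyLipschitz_insertCoord (i : Fin n) (y : {j : Fin n // j ≠ i} → ℝ) :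
    LocallyLipschitz fun t => insertCoord i t y := by
  rw [show (fun t => insertCoord i t y) = _ from funext fun t => insertCoord_eq i t y]
  exact ContDiff.locallyLipschitz (𝕂 := ℝ) (contDiff_const.add (contDiff_id.smul contDiff_const))

theorem continuous_insertCoord (i : Fin n) (t : ℝ) :
    Continuous fun y : {j : Fin n // j ≠ i} → ℝ => insertCoord i t y := by
  refine (PiLp.continuous_toLp 2 _).comp (continuous_pi fun j => ?_)
  by_cases h : j = i
  · simp only [h, dite_true]; fun_prop
  · simp only [h, dite_false]; fun_prop

theorem insertCoord_ne_zero (i : Fin n) (t : ℝ) {y : {j : Fin n // j ≠ i} → ℝ} (hy : y ≠ 0) :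
    insertCoord i t y ≠ 0 := fun h => hy <| by
  ext j
  have := congrArg (fun z : E n => z j) h
  simpa [insertCoord, j.2] using this

theorem ae_ne_zero_of_two_le (hn : 2 ≤ n) (i : Fin n) :
    ∀ᵐ y : {j : Fin n // j ≠ i} → ℝ, y ≠ 0 := by
  have : Nontrivial (Fin n) := Fin.nontrivial_iff_two_le.2 hn
  obtain ⟨j, hj⟩ := exists_ne i
  have : Nonempty {j : Fin n // j ≠ i} := ⟨⟨j, hj⟩⟩
  exact Measure.ae_ne volume 0

theorem insertCoord_update (i : Fin n) (t : ℝ) (r : Fin n → ℝ) :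
    insertCoord i t (fun j => r j) = WithLp.toLp 2 (Function.update r i t) := by
  ext j
  by_cases h : j = i
  · subst h; simp [insertCoord]
  · simp [insertCoord, h]

/-! ### Absolute continuity on lines -/

/-- Almost every line parallel to an axis misses the origin, and along such a line f is Lipschitz on
compact intervals. -/
theorem isACL_of_locallyLipschitzOn (hn : 2 ≤ n) {f : E n → E n} (hc : Continuous f)
    (hf : LocallyLipschitzOn {0}ᶜ f) : IsACL f := by
  refine ⟨hc, fun c d _ i => ?_⟩
  filter_upwards [ae_ne_zero_of_two_le hn i] with y hy _
  have h1 : LocallyLipschitzOn (uIcc (c i) (d i)) fun t => f (insertCoord i t y) := fun t _ => by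
    obtain ⟨K, s, hs, hK⟩ := hf (insertCoord_ne_zero i t hy)
    rw [isOpen_compl_singleton.nhdsWithin_eq (insertCoord_ne_zero i t hy)] at hs
    obtain ⟨C, s', hs', hC⟩ := locallyLipschitz_insertCoord i y t
    exact ⟨K * C, s' ∩ (fun t => insertCoord i t y) ⁻¹' s, mem_nhdsWithin_of_mem_nhds
      (inter_mem hs' ((locallyLipschitz_insertCoord i y).continuous.continuousAt hs)),
      hK.comp (hC.mono inter_subset_left) fun z hz => hz.2⟩
  obtain ⟨K, hK⟩ := h1.exists_lipschitzOnWith_of_compact isCompact_uIcc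
  exact hK.absolutelyContinuousOnInterval

theorem absolutelyContinuousOnInterval_log_norm {g : ℝ → E n} {c d : ℝ}
    (hg : AbsolutelyContinuousOnInterval g c d) (h0 : ∀ t, g t ≠ 0) :
    AbsolutelyContinuousOnInterval (fun t => Real.log ‖g t‖) c d := by
  have h1 : LocallyLipschitzOn (g '' uIcc c d) fun x : E n => Real.log ‖x‖ :=
    locallyLipschitzOn_of_contDiffAt fun x hx => by
      obtain ⟨t, -, rfl⟩ := hx
      exact contDiffAt_log_norm (h0 t)
  have h2 : IsCompact (g '' uIcc c d) := isCompact_uIcc.image_of_continuousOn hg.continuousOn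
  obtain ⟨K, hK⟩ := LocallyLipschitzOn.exists_lipschitzOnWith_of_compact h2 h1
  exact hg.lipschitzOnWith_comp hK (mapsTo_image g _)

/-- An ACL radial stretching with bounded angular derivative is locally Lipschitz on almost every
line parallel to a coordinate axis. -/
theorem ae_abs_sub_le_of_isACL (hn : 2 ≤ n) {ψ : E n → ℝ} {a M ρ : ℝ}
    (hρ : 0 < ρ) (hACL : IsACL (stretch a ψ))
    (h : ∀ᵐ z : E n, z ≠ 0 → ∃ ψ' : E n →L[ℝ] ℝ, HasFDerivAt ψ ψ' z ∧ ‖z‖ * ‖ψ'‖ ≤ M)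
    {c d : Fin n → ℝ} (hcd : c ≤ d)
    (hb : ∀ z : E n, (∀ j, z j ∈ Icc (c j) (d j)) → ρ ≤ ‖z‖) (i : Fin n) :
    ∀ᵐ y : {j : Fin n // j ≠ i} → ℝ, (∀ j : {j : Fin n // j ≠ i}, y j ∈ Icc (c j) (d j)) →
      ∀ s ∈ Icc (c i) (d i), ∀ t ∈ Icc (c i) (d i),
        |ψ (insertCoord i t y) - ψ (insertCoord i s y)| ≤ M / ρ * |t - s| := by
  filter_upwards [hACL.2 c d hcd i, ae_ne_zero_of_two_le hn i, ae_ae_insertCoord h i]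
    with y hy hy0 hyd hyb s hs t ht
  have hne := fun t => insertCoord_ne_zero i t hy0
  have hAC := (absolutelyContinuousOnInterval_log_norm (hy hyb)
    fun t => stretch_ne_zero a ψ (hne t)).sub
    ((absolutelyContinuousOnInterval_log_norm ((contDiff_const.add
      (contDiff_id.smul contDiff_const)).contDiffOn.absolutelyContinuousOnInterval
      (f := fun t : ℝ => insertCoord i 0 y + t • EuclideanSpace.single i (1 : ℝ))
      (a := c i) (b := d i))
      fun t => by rw [← insertCoord_eq]; exact hne t).const_mul a)
  -- Absolute continuity of ψ on the line is read off from log‖stretch‖ - a log‖·‖.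
  have heq : ((fun t => Real.log ‖stretch a ψ (insertCoord i t y)‖) - fun t =>
      a * Real.log ‖insertCoord i 0 y + t • EuclideanSpace.single i (1 : ℝ)‖) =
      fun t => ψ (insertCoord i t y) := by
    ext t
    rw [Pi.sub_apply, log_norm_stretch a ψ (hne t), ← insertCoord_eq]
    ring
  rw [heq] at hAC
  refine (hAC.mono ?_).abs_sub_le_of_ae_deriv_le ?_
  · rw [uIcc_of_le (hcd i)]; exact uIcc_subset_Icc hs ht
  · filter_upwards [hyd] with τ hτ hmem
    obtain ⟨ψ', hd, hM⟩ := hτ (hne τ)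
    have hτ' : τ ∈ Icc (c i) (d i) := uIcc_subset_Icc hs ht (uIoc_subset_uIcc hmem)
    have hz : ρ ≤ ‖insertCoord i τ y‖ := hb _ fun j => by
      by_cases hj : j = i
      · subst hj; simpa [insertCoord] using hτ'
      · simpa [insertCoord, hj] using hyb ⟨j, hj⟩
    have hder : HasDerivAt (fun t => ψ (insertCoord i t y))
        (ψ' (EuclideanSpace.single i (1 : ℝ))) τ := hd.comp_hasDerivAt τ (hasDerivAt_insertCoord i y τ)
    rw [hder.deriv, ← Real.norm_eq_abs]
    refine (ψ'.le_opNorm _).trans ?_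
    rw [PiLp.norm_single, norm_one, mul_one, le_div_iff₀ hρ]
    refine le_trans ?_ hM
    rw [mul_comm]
    gcongr

/-- The Lipschitz bound on almost every axis-parallel segment extends to all such segments in a
small cube because ψ is continuous. Two points of the cube are then joined by changing one
coordinate at a time. -/
theorem locallyLipschitzOn_of_isACL (hn : 2 ≤ n) {ψ : E n → ℝ} (hψ : IsAngular ψ) {a M : ℝ}
    (hACL : IsACL (stretch a ψ))
    (h : ∀ᵐ z : E n, z ≠ 0 → ∃ ψ' : E n →L[ℝ] ℝ, HasFDerivAt ψ ψ' z ∧ ‖z‖ * ‖ψ'‖ ≤ M) :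
    LocallyLipschitzOn {0}ᶜ ψ := by
  intro x hx
  have hx' : 0 < ‖x‖ := norm_pos_iff.2 hx
  set ρ := ‖x‖ / 2
  have hρ : 0 < ρ := half_pos hx'
  have hU : {p : Fin n → ℝ | ρ < ‖(WithLp.toLp 2 p : E n)‖} ∈ 𝓝 (WithLp.ofLp x) := by
    have : ContinuousAt (fun p : Fin n → ℝ => ‖(WithLp.toLp 2 p : E n)‖) (WithLp.ofLp x) :=
      ((PiLp.continuous_toLp 2 _).norm).continuousAt
    exact this (lt_mem_nhds (half_lt_self hx'))
  -- Balls of `Fin n → ℝ` are taken in the sup metric, so this is a closed cube that stays at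
  -- distance more than ρ from the origin.
  obtain ⟨ε, hε, hεU⟩ := Metric.nhds_basis_closedBall.mem_iff.1 hU
  have hb : ∀ z : E n, (∀ j, z j ∈ Icc (x j - ε) (x j + ε)) → ρ ≤ ‖z‖ := fun z hz => by
    have : WithLp.ofLp z ∈ Metric.closedBall (WithLp.ofLp x) ε := by
      rw [Metric.mem_closedBall, dist_pi_le_iff hε.le]
      intro j
      rw [Real.dist_eq, abs_le]
      have := hz j
      constructor <;> [linarith [this.1]; linarith [this.2]]
    exact (le_of_lt (hεU this))
  have hcd : (fun j => x j - ε) ≤ fun j => x j + ε := fun j => by dsimp only; linarith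
  have hline : ∀ (i : Fin n) (y : {j : Fin n // j ≠ i} → ℝ),
      (∀ j : {j : Fin n // j ≠ i}, y j ∈ Ioo (x j - ε) (x j + ε)) →
      ∀ s ∈ Icc (x i - ε) (x i + ε), ∀ t ∈ Icc (x i - ε) (x i + ε),
        |ψ (insertCoord i t y) - ψ (insertCoord i s y)| ≤ M / ρ * |t - s| := by
    intro i y hy s hs t ht
    have hae := ae_abs_sub_le_of_isACL hn hρ hACL h hcd hb i
    have hcont : ∀ s ∈ Icc (x i - ε) (x i + ε),
        Tendsto (fun y => ψ (insertCoord i s y)) (𝓝 y) (𝓝 (ψ (insertCoord i s y))) := by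
      intro s hs
      have hne : insertCoord i s y ≠ 0 := norm_pos_iff.1 <| hρ.trans_le <| hb _ fun j => by
        by_cases hj : j = i
        · subst hj; simpa [insertCoord] using hs
        · simpa [insertCoord, hj] using Ioo_subset_Icc_self (hy ⟨j, hj⟩)
      exact (hψ.continuousAt hne).tendsto.comp ((continuous_insertCoord i s).tendsto y)
    refine le_of_tendsto_of_frequently ((hcont t ht).sub (hcont s hs)).abs ?_
    have hfr := mem_closure_iff_frequently.1 (Measure.dense_of_ae hae y)
    have hev : ∀ᶠ y' in 𝓝 y, ∀ j : {j : Fin n // j ≠ i}, y' j ∈ Ioo (x j - ε) (x j + ε) :=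
      eventually_all.2 fun j => (continuous_apply j).continuousAt (isOpen_Ioo.mem_nhds (hy j))
    refine (hfr.and_eventually hev).mono ?_
    rintro y' ⟨h1, h2⟩
    exact h1 (fun j => Ioo_subset_Icc_self (h2 j)) s hs t ht
  -- `S.piecewise p q` is q with its coordinates in S replaced by those of p; the case of all
  -- coordinates is the path from q to p.
  have hchain : ∀ p q : Fin n → ℝ, (∀ j, p j ∈ Ioo (x j - ε) (x j + ε)) →
      (∀ j, q j ∈ Ioo (x j - ε) (x j + ε)) → ∀ S : Finset (Fin n),
      |ψ (WithLp.toLp 2 (S.piecewise p q)) - ψ (WithLp.toLp 2 q)| ≤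
        ∑ i ∈ S, M / ρ * |p i - q i| := by
    intro p q hp hq S
    induction S using Finset.induction_on with
    | empty => simp
    | insert i S hi ih =>
      rw [Finset.sum_insert hi, Finset.piecewise_insert, ← insertCoord_update]
      have h1 : ∀ j, S.piecewise p q j ∈ Ioo (x j - ε) (x j + ε) := fun j => by
        by_cases hj : j ∈ S <;> simp only [hj, not_false_eq_true, Finset.piecewise_eq_of_mem,
          Finset.piecewise_eq_of_notMem, hp, hq]
      have h2 := hline i (fun j => S.piecewise p q j) (fun j => h1 j) (q i)
        (Ioo_subset_Icc_self (hq i)) (p i) (Ioo_subset_Icc_self (hp i))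
      have h3 : insertCoord i (q i) (fun j => S.piecewise p q j) =
          WithLp.toLp 2 (S.piecewise p q) := by
        rw [insertCoord_update]
        congr 1
        rw [Function.update_eq_self_iff]
        exact (Finset.piecewise_eq_of_notMem _ _ _ hi).symm
      rw [h3] at h2
      calc _ ≤ _ + _ := abs_sub_le _ (ψ (WithLp.toLp 2 (S.piecewise p q))) _
        _ ≤ _ := add_le_add h2 ih
  have hV : {z : E n | ∀ j, z j ∈ Ioo (x j - ε) (x j + ε)} ∈ 𝓝 x := by
    refine eventually_all.2 fun j => ?_
    have : ContinuousAt (fun z : E n => z j) x := by fun_prop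
    exact this (Ioo_mem_nhds (by linarith) (by linarith))
  refine ⟨(M / ρ * n).toNNReal, _, mem_nhdsWithin_of_mem_nhds hV,
    LipschitzOnWith.of_dist_le_mul fun p hp q hq => ?_⟩
  have := hchain p q hp hq Finset.univ
  rw [Finset.piecewise_univ] at this
  rw [Real.dist_eq, dist_eq_norm]
  refine (this.trans ?_).trans
    (mul_le_mul_of_nonneg_right (Real.le_coe_toNNReal _) (norm_nonneg _))
  have hM : 0 ≤ M := by
    have : ∀ᵐ z : E n, z ≠ 0 := by
      have : Nontrivial (E n) := ⟨x, 0, hx⟩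
      exact Measure.ae_ne volume 0
    obtain ⟨z, hz, hz0⟩ := (h.and this).exists
    obtain ⟨ψ', -, h2⟩ := hz hz0
    exact le_trans (by positivity) h2
  calc ∑ i, M / ρ * |p i - q i| ≤ ∑ _i : Fin n, M / ρ * ‖p - q‖ := by
        gcongr with i
        simpa using PiLp.norm_apply_le (p - q) i
    _ = M / ρ * n * ‖p - q‖ := by simp; ring

/-! ### Quasiconformality of radial stretchings -/

theorem stretch_distortion (hn : 2 ≤ n) {ψ : E n → ℝ} (hψ : IsAngular ψ) {a : ℝ} (ha : 0 < a)
    {x : E n} (hx : x ≠ 0) {ψ' : E n →L[ℝ] ℝ} (h : HasFDerivAt ψ ψ' x) :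
    ∃ c : ℝ, 0 < c ∧ DifferentiableAt ℝ (stretch a ψ) x ∧
      maxStretch (stretch a ψ) x = c * singMax a (‖x‖ * ‖ψ'‖) ∧
      minStretch (stretch a ψ) x = c * (a / singMax a (‖x‖ * ‖ψ'‖)) ∧
      jacobian (stretch a ψ) x = c ^ n * a := by
  obtain ⟨G, T, hT, hG, hGn, hTv⟩ := exists_hasFDerivAt_stretch a hψ hx h
  have hu : ‖‖x‖⁻¹ • x‖ = 1 := by simp [norm_smul, hx]
  refine ⟨Real.exp ((a - 1) * Real.log ‖x‖ + ψ x), Real.exp_pos _, hT.differentiableAt, ?_, ?_, ?_⟩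
  · rw [maxStretch, hT.fderiv, opNorm_stretching hn hu hG ha (Real.exp_pos _) hTv, hGn]
  · rw [minStretch, hT.fderiv, iInf_norm_stretching hn hu hG ha (Real.exp_pos _) hTv, hGn]
  · rw [jacobian, hT.fderiv, det_stretching hu hG hTv]

theorem ae_ne_zero (hn : 2 ≤ n) : ∀ᵐ z : E n, z ≠ 0 := by
  obtain ⟨w, hw, -⟩ := exists_ne_zero_inner_eq_zero hn 0
  have : Nontrivial (E n) := ⟨w, 0, hw⟩
  exact Measure.ae_ne volume 0

theorem isQuasiconformalWith_stretch (hn : 2 ≤ n) {ψ : E n → ℝ} (hψ : IsAngular ψ) {a m : ℝ}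
    (ha : 0 < a) (hm : 0 ≤ m) (h : ∀ x, x ≠ 0 → PointwiseLip ψ x (m / ‖x‖)) :
    IsQuasiconformalWith (singMax a m ^ 2 / a) (stretch a ψ) := by
  have hloc := locallyLipschitzOn_of_pointwiseLip hm h
  have hS := singMax_pos ha m
  -- Here s is `singMax` at the actual gradient. Only s ≤ `singMax a m` is known, and this one bound
  -- controls all three distortion inequalities.
  have key : ∀ᵐ x : E n, ∃ c s : ℝ, 0 < c ∧ 0 < s ∧ s ≤ singMax a m ∧
      DifferentiableAt ℝ (stretch a ψ) x ∧ maxStretch (stretch a ψ) x = c * s ∧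
      minStretch (stretch a ψ) x = c * (a / s) ∧ jacobian (stretch a ψ) x = c ^ n * a := by
    filter_upwards [ae_ne_zero hn, ae_differentiableAt_of_locallyLipschitzOn (μ := volume)
      isOpen_compl_singleton hloc] with x hx hd
    have hd := (hd hx).hasFDerivAt
    have hx' := norm_pos_iff.2 hx
    obtain ⟨c, hc, h1, h2, h3, h4⟩ := stretch_distortion hn hψ ha hx hd
    refine ⟨c, _, hc, singMax_pos ha _, ?_, h1, h2, h3, h4⟩
    refine (singMax_strictMonoOn a).monotoneOn (by simp; positivity) hm ?_
    rw [mul_comm, ← le_div_iff₀ hx']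
    exact (h x hx).norm_fderiv_le (by positivity) hd
  refine ⟨⟨(stretchHomeomorph ha hψ).isHomeomorph, isACL_of_locallyLipschitzOn hn
    (continuous_stretch ha hψ) (locallyLipschitzOn_stretch a hloc), ?_,
    -- The sum dominates the two constants needed for the two sides of the Jacobian inequality.
    singMax a m ^ n / a + a * (singMax a m / a) ^ n, by positivity, ?_⟩, ?_⟩
  · filter_upwards [key] with x hx
    obtain ⟨c, s, hc, hs, hsS, h1, -⟩ := hx
    exact h1
  · filter_upwards [key] with x hx
    obtain ⟨c, s, hc, hs, hsS, -, h1, h2, h3⟩ := hx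
    rw [h1, h2, h3, abs_of_pos (by positivity)]
    constructor
    · rw [div_le_iff₀ (by positivity), mul_pow]
      calc c ^ n * s ^ n ≤ c ^ n * singMax a m ^ n := by gcongr
        _ = c ^ n * a * (singMax a m ^ n / a) := by field_simp
        _ ≤ _ := by gcongr; exact le_add_of_nonneg_right (by positivity)
    · calc c ^ n * a = a * (s / a) ^ n * (c * (a / s)) ^ n := by
            rw [mul_assoc, ← mul_pow, show s / a * (c * (a / s)) = c by field_simp]; ring
        _ ≤ a * (singMax a m / a) ^ n * (c * (a / s)) ^ n := by gcongr
        _ ≤ _ := by gcongr; exact le_add_of_nonneg_left (by positivity)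
  · filter_upwards [key] with x hx
    obtain ⟨c, s, hc, hs, hsS, -, h1, h2, -⟩ := hx
    rw [h1, h2]
    calc c * s = s ^ 2 / a * (c * (a / s)) := by field_simp
      _ ≤ _ := by gcongr

theorem ae_singMax_le_of_isQuasiconformalWith (hn : 2 ≤ n) {ψ : E n → ℝ} (hψ : IsAngular ψ)
    {a K : ℝ} (ha : 0 < a) (h : IsQuasiconformalWith K (stretch a ψ)) :
    ∀ᵐ z : E n, z ≠ 0 → ∃ ψ' : E n →L[ℝ] ℝ, HasFDerivAt ψ ψ' z ∧
      singMax a (‖z‖ * ‖ψ'‖) ^ 2 / a ≤ K := by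
  filter_upwards [h.1.2.2.1, h.2] with z hd hK hz
  have hd' := (hasFDerivAt_angular hz hd).hasFDerivAt
  obtain ⟨c, hc, -, h2, h3, -⟩ := stretch_distortion hn hψ ha hz hd'
  refine ⟨_, hd', ?_⟩
  have hs := singMax_pos ha (‖z‖ * ‖fderiv ℝ ψ z‖)
  rw [h2, h3] at hK
  rw [div_le_iff₀ ha]
  have h4 : c * singMax a (‖z‖ * ‖fderiv ℝ ψ z‖) ^ 2 ≤ c * (K * a) := by
    calc _ = c * singMax a (‖z‖ * ‖fderiv ℝ ψ z‖) * singMax a (‖z‖ * ‖fderiv ℝ ψ z‖) := by ring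
      _ ≤ K * (c * (a / singMax a (‖z‖ * ‖fderiv ℝ ψ z‖))) * singMax a (‖z‖ * ‖fderiv ℝ ψ z‖) := by
        gcongr
      _ = _ := by field_simp
  exact le_of_mul_le_mul_left h4 hc

/-- A quasiconformality constant of a radial stretching bounds the pointwise Lipschitz constants of
its angular part. -/
theorem pointwiseLip_of_isQuasiconformalWith (hn : 2 ≤ n) {ψ : E n → ℝ} (hψ : IsAngular ψ)
    {a K m : ℝ} (ha : 0 < a) (h : IsQuasiconformalWith K (stretch a ψ)) (hm : 0 ≤ m)
    (hK : K ≤ singMax a m ^ 2 / a) {x : E n} (hx : x ≠ 0) : PointwiseLip ψ x (m / ‖x‖) := by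
  have key : ∀ᵐ z : E n, z ≠ 0 → ∃ ψ' : E n →L[ℝ] ℝ, HasFDerivAt ψ ψ' z ∧ ‖z‖ * ‖ψ'‖ ≤ m := by
    filter_upwards [ae_singMax_le_of_isQuasiconformalWith hn hψ ha h] with z hz hz0
    obtain ⟨ψ', hd, h1⟩ := hz hz0
    refine ⟨ψ', hd, ?_⟩
    by_contra! hlt
    have h2 := singMax_strictMonoOn a hm (hm.trans hlt.le) hlt
    have h3 := div_lt_div_of_pos_right
      (pow_lt_pow_left₀ h2 (singMax_pos ha m).le two_ne_zero) ha
    linarith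
  -- The almost everywhere bound enters twice: with ACL it gives local Lipschitz continuity, and
  -- then the sharp pointwise constant.
  refine pointwiseLip_of_ae (locallyLipschitzOn_of_isACL hn hψ h.1.2.1 key) hm hx
    univ_mem ?_
  filter_upwards [key, ae_ne_zero hn] with z hz hz0 _ ψ' hd
  obtain ⟨ψ'', hd', h1⟩ := hz hz0
  rwa [hd.unique hd']

/-- Settles optimality when cot α = 0, where no smaller slope is available for a contradiction. -/
theorem singMax_zero_le_of_isQuasiconformalWith (hn : 2 ≤ n) {ψ : E n → ℝ} (hψ : IsAngular ψ)
    {a K : ℝ} (ha : 0 < a) (h : IsQuasiconformalWith K (stretch a ψ)) :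
    singMax a 0 ^ 2 / a ≤ K := by
  obtain ⟨z, hz, hz0⟩ :=
    ((ae_singMax_le_of_isQuasiconformalWith hn hψ ha h).and (ae_ne_zero hn)).exists
  obtain ⟨ψ', -, h1⟩ := hz hz0
  refine le_trans ?_ h1
  have hp : 0 ≤ ‖z‖ * ‖ψ'‖ := by positivity
  have := (singMax_strictMonoOn a).monotoneOn (mem_Ici.2 le_rfl) (mem_Ici.2 hp) hp
  have := singMax_pos ha 0
  gcongr

end RadialStretch

namespace RadialStretch

variable {n : ℕ} {D : Set (E n)}

/-! ### Strictly starlike domains -/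

theorem _root_.IsPreconnected.exists_mem_frontier {X : Type*} [TopologicalSpace X] {s t : Set X}
    (hs : IsPreconnected s) (h1 : (s ∩ t).Nonempty) (h2 : (s ∩ tᶜ).Nonempty) :
    (s ∩ frontier t).Nonempty := by
  by_contra hc
  have hdis : ∀ x ∈ s, x ∉ frontier t := fun x hx hf => hc ⟨x, hx, hf⟩
  obtain ⟨x, hx, hxt⟩ := h1
  obtain ⟨y, hy, hyt⟩ := h2
  have hcov : s ⊆ interior t ∪ (closure t)ᶜ := fun z hz => by
    by_contra h
    simp only [mem_union, mem_compl_iff, not_or, not_not] at h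
    exact hdis z hz ⟨h.2, h.1⟩
  obtain ⟨z, -, hz1, hz2⟩ := hs _ _ isOpen_interior isClosed_closure.isOpen_compl hcov
    ⟨x, hx, (hcov hx).resolve_right fun h => h (subset_closure hxt)⟩
    ⟨y, hy, (hcov hy).resolve_left fun h => hyt (interior_subset h)⟩
  exact hz2 (subset_closure (interior_subset hz1))

namespace StrictlyStarlike

theorem eq_of_smul_mem_frontier (hD : StrictlyStarlike 0 D) {v : E n} (hv : v ≠ 0) {s t : ℝ}
    (hs : 0 ≤ s) (ht : 0 ≤ t) (hsv : s • v ∈ frontier D) (htv : t • v ∈ frontier D) : s = t :=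
  smul_left_injective ℝ hv <|
    (hD.existsUnique_frontier v hv).unique ⟨hsv, s, hs, by simp⟩ ⟨htv, t, ht, by simp⟩

theorem notMem_frontier_of_mem (hD : StrictlyStarlike 0 D) {v : E n} (hv : v ∈ D) :
    v ∉ frontier D := fun h => by
  rw [hD.isOpen.frontier_eq] at h
  exact h.2 hv

theorem exists_one_lt_smul_mem_frontier (hD : StrictlyStarlike 0 D) {v : E n} (hv : v ∈ D)
    (hv0 : v ≠ 0) : ∃ t : ℝ, 1 < t ∧ t • v ∈ frontier D := by
  have hc : IsPreconnected ((fun t : ℝ => t • v) '' Ici 1) :=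
    isPreconnected_Ici.image _ (by fun_prop)
  have h1 : (((fun t : ℝ => t • v) '' Ici 1) ∩ D).Nonempty :=
    ⟨v, ⟨1, self_mem_Ici, one_smul ℝ v⟩, hv⟩
  have h2 : (((fun t : ℝ => t • v) '' Ici 1) ∩ Dᶜ).Nonempty := by
    obtain ⟨C, hC⟩ := hD.isBounded.exists_norm_le
    have hv' := norm_pos_iff.2 hv0
    refine ⟨(max 1 ((C + 1) / ‖v‖)) • v, ⟨_, mem_Ici.2 (le_max_left _ _), rfl⟩, fun hmem => ?_⟩
    have h3 := hC _ hmem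
    rw [norm_smul, Real.norm_of_nonneg (by positivity)] at h3
    have h4 : (C + 1) / ‖v‖ * ‖v‖ ≤ max 1 ((C + 1) / ‖v‖) * ‖v‖ := by
      gcongr; exact le_max_right _ _
    rw [div_mul_cancel₀ _ hv'.ne'] at h4
    linarith
  obtain ⟨_, ⟨t, ht, rfl⟩, htf⟩ := hc.exists_mem_frontier h1 h2
  refine ⟨t, lt_of_le_of_ne ht ?_, htf⟩
  rintro rfl
  exact hD.notMem_frontier_of_mem hv (by simpa using htf)

theorem exists_smul_mem_frontier_of_zero_mem (h0 : (0 : E n) ∈ D) {v : E n} (hv : v ∉ D) :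
    ∃ t ∈ Icc (0 : ℝ) 1, t • v ∈ frontier D := by
  have hc : IsPreconnected ((fun t : ℝ => t • v) '' Icc 0 1) :=
    isPreconnected_Icc.image _ (by fun_prop)
  obtain ⟨_, ⟨t, ht, rfl⟩, htf⟩ := hc.exists_mem_frontier
    ⟨0, ⟨0, by simp, zero_smul ℝ v⟩, h0⟩ ⟨v, ⟨1, by simp, one_smul ℝ v⟩, hv⟩
  exact ⟨t, ht, htf⟩

theorem exists_ne_zero_mem (hn : 2 ≤ n) (hD : StrictlyStarlike 0 D) : ∃ v ∈ D, v ≠ 0 := by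
  obtain ⟨w, hw, -⟩ := exists_ne_zero_inner_eq_zero hn 0
  by_contra! h
  have hv : D = {0} := (hD.isConnected.nonempty.subset_singleton_iff).1 fun v hv => h v hv
  have : Nontrivial (E n) := ⟨w, 0, hw⟩
  exact not_isOpen_singleton (0 : E n) (hv ▸ hD.isOpen)

/-- Otherwise the ray through a nonzero point v of D would meet the boundary at 0 and again beyond
v. -/
theorem zero_notMem_frontier (hn : 2 ≤ n) (hD : StrictlyStarlike 0 D) :
    (0 : E n) ∉ frontier D := fun h => by
  obtain ⟨v, hv, hv0⟩ := hD.exists_ne_zero_mem hn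
  obtain ⟨t, ht, htf⟩ := hD.exists_one_lt_smul_mem_frontier hv hv0
  have := hD.eq_of_smul_mem_frontier hv0 le_rfl (by linarith) (by simpa using h) htf
  linarith

/-- If 0 were outside D, the segment [0, v] with v in D would meet the boundary, and the ray would
meet it again beyond v. -/
theorem zero_mem (hn : 2 ≤ n) (hD : StrictlyStarlike 0 D) : (0 : E n) ∈ D := by
  by_contra h
  obtain ⟨v, hv, hv0⟩ := hD.exists_ne_zero_mem hn
  obtain ⟨t, ht, htf⟩ := hD.exists_one_lt_smul_mem_frontier hv hv0
  have hc : IsPreconnected ((fun t : ℝ => t • v) '' Icc 0 1) :=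
    isPreconnected_Icc.image _ (by fun_prop)
  obtain ⟨_, ⟨s, hs, rfl⟩, hsf⟩ := hc.exists_mem_frontier
    ⟨v, ⟨1, by simp, one_smul ℝ v⟩, hv⟩ ⟨0, ⟨0, by simp, zero_smul ℝ v⟩, h⟩
  have := hD.eq_of_smul_mem_frontier hv0 hs.1 (by linarith) hsf htf
  linarith [hs.2]

theorem ne_zero_of_mem_frontier (hn : 2 ≤ n) (hD : StrictlyStarlike 0 D) {x : E n}
    (hx : x ∈ frontier D) : x ≠ 0 := fun h => hD.zero_notMem_frontier hn (h ▸ hx)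

theorem exists_pos_smul_mem_frontier (hn : 2 ≤ n) (hD : StrictlyStarlike 0 D) {v : E n}
    (hv : v ≠ 0) : ∃ t : ℝ, 0 < t ∧ t • v ∈ frontier D := by
  obtain ⟨z, ⟨hz, t, ht, hzt⟩, -⟩ := hD.existsUnique_frontier v hv
  rw [zero_add] at hzt
  subst hzt
  refine ⟨t, ht.lt_of_ne ?_, hz⟩
  rintro rfl
  exact hD.zero_notMem_frontier hn (by simpa using hz)

theorem polarRadius_eq (hD : StrictlyStarlike 0 D) {v : E n} (hv : v ≠ 0) {t : ℝ} (ht : 0 < t)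
    (h : t • v ∈ frontier D) : polarRadius D v = t := by
  have : {s : ℝ | 0 < s ∧ s • v ∈ frontier D} = {t} := by
    ext s
    refine ⟨fun hs => hD.eq_of_smul_mem_frontier hv hs.1.le ht.le hs.2 h, ?_⟩
    rintro rfl
    exact ⟨ht, h⟩
  rw [polarRadius, this, csSup_singleton]

theorem polarRadius_pos (hn : 2 ≤ n) (hD : StrictlyStarlike 0 D) {v : E n} (hv : v ≠ 0) :
    0 < polarRadius D v := by
  obtain ⟨t, ht, h⟩ := hD.exists_pos_smul_mem_frontier hn hv
  rwa [hD.polarRadius_eq hv ht h]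

theorem polarRadius_smul_mem (hn : 2 ≤ n) (hD : StrictlyStarlike 0 D) {v : E n} (hv : v ≠ 0) :
    polarRadius D v • v ∈ frontier D := by
  obtain ⟨t, ht, h⟩ := hD.exists_pos_smul_mem_frontier hn hv
  rwa [hD.polarRadius_eq hv ht h]

theorem smul_mem_iff (hn : 2 ≤ n) (hD : StrictlyStarlike 0 D) {v : E n} (hv : v ≠ 0) {t : ℝ}
    (ht : 0 < t) : t • v ∈ D ↔ t < polarRadius D v := by
  have hr := hD.polarRadius_pos hn hv
  have hrm := hD.polarRadius_smul_mem hn hv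
  constructor
  · intro h
    obtain ⟨s, hs, hsf⟩ := hD.exists_one_lt_smul_mem_frontier h (smul_ne_zero ht.ne' hv)
    rw [smul_smul] at hsf
    rw [hD.polarRadius_eq hv (by positivity) hsf]
    nlinarith
  · intro h
    by_contra hc
    obtain ⟨s, hs, hsf⟩ := exists_smul_mem_frontier_of_zero_mem (hD.zero_mem hn) hc
    rw [smul_smul] at hsf
    have := hD.eq_of_smul_mem_frontier hv (mul_nonneg hs.1 ht.le) hr.le hsf hrm
    nlinarith [hs.2]

theorem smul_mem_closure_iff (hn : 2 ≤ n) (hD : StrictlyStarlike 0 D) {v : E n} (hv : v ≠ 0)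
    {t : ℝ} (ht : 0 < t) : t • v ∈ closure D ↔ t ≤ polarRadius D v := by
  rw [closure_eq_self_union_frontier, mem_union, hD.smul_mem_iff hn hv ht, le_iff_lt_or_eq]
  refine or_congr_right ⟨fun h => (hD.polarRadius_eq hv ht h).symm, ?_⟩
  rintro rfl
  exact hD.polarRadius_smul_mem hn hv

/-- The conditions s < r(v) and r(v) < s are open in v, since they say s • v ∈ D and s • v ∉ closure
D. -/
theorem continuousOn_polarRadius (hn : 2 ≤ n) (hD : StrictlyStarlike 0 D) :
    ContinuousOn (polarRadius D) {0}ᶜ := by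
  intro v hv
  refine ContinuousAt.continuousWithinAt (tendsto_order.2 ⟨fun s hs => ?_, fun s hs => ?_⟩)
  · have hne : ∀ᶠ w in 𝓝 v, w ≠ 0 := isOpen_compl_singleton.mem_nhds hv
    rcases le_or_gt s 0 with h0 | h0
    · filter_upwards [hne] with w hw using h0.trans_lt (hD.polarRadius_pos hn hw)
    · have hmem : s • v ∈ D := (hD.smul_mem_iff hn hv h0).2 hs
      have hcont : ContinuousAt (fun w : E n => s • w) v := by fun_prop
      filter_upwards [hne, hcont (hD.isOpen.mem_nhds hmem)] with w hw hws
      exact (hD.smul_mem_iff hn hw h0).1 hws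
  · have hne : ∀ᶠ w in 𝓝 v, w ≠ 0 := isOpen_compl_singleton.mem_nhds hv
    have h0 := (hD.polarRadius_pos hn hv).trans hs
    have hmem : s • v ∈ (closure D)ᶜ := fun h =>
      hs.not_ge ((hD.smul_mem_closure_iff hn hv h0).1 h)
    have hcont : ContinuousAt (fun w : E n => s • w) v := by fun_prop
    filter_upwards [hne, hcont (isClosed_closure.isOpen_compl.mem_nhds hmem)] with w hw hws
    by_contra! hle
    exact hws ((hD.smul_mem_closure_iff hn hw h0).2 hle)

end StrictlyStarlike

/-- The logarithm of the polar radius, extended to be homogeneous of degree `0`. -/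
noncomputable def logRadius (D : Set (E n)) (x : E n) : ℝ :=
  Real.log (polarRadius D (‖x‖⁻¹ • x))

theorem inv_norm_smul_ne_zero {x : E n} (hx : x ≠ 0) : ‖x‖⁻¹ • x ≠ 0 :=
  smul_ne_zero (inv_ne_zero (norm_ne_zero_iff.2 hx)) hx

namespace StrictlyStarlike

theorem exp_logRadius (hn : 2 ≤ n) (hD : StrictlyStarlike 0 D) {x : E n} (hx : x ≠ 0) :
    Real.exp (logRadius D x) = polarRadius D (‖x‖⁻¹ • x) :=
  Real.exp_log (hD.polarRadius_pos hn (inv_norm_smul_ne_zero hx))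

theorem logRadius_of_mem_frontier (hn : 2 ≤ n) (hD : StrictlyStarlike 0 D) {x : E n}
    (hx : x ∈ frontier D) : logRadius D x = Real.log ‖x‖ := by
  have hx0 := hD.ne_zero_of_mem_frontier hn hx
  have hx' := norm_pos_iff.2 hx0
  rw [logRadius, hD.polarRadius_eq (inv_norm_smul_ne_zero hx0) hx']
  rwa [smul_smul, mul_inv_cancel₀ hx'.ne', one_smul]

theorem isAngular_logRadius (hn : 2 ≤ n) (hD : StrictlyStarlike 0 D) :
    IsAngular (logRadius D) := by
  refine ⟨fun x t ht => ?_, ?_⟩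
  · have : ‖t • x‖⁻¹ • t • x = ‖x‖⁻¹ • x := by
      rw [norm_smul, Real.norm_of_nonneg ht.le, smul_smul]
      congr 1
      field_simp
    rw [logRadius, this, logRadius]
  · refine ContinuousOn.log ?_ fun x hx =>
      (hD.polarRadius_pos hn (inv_norm_smul_ne_zero hx)).ne'
    refine (hD.continuousOn_polarRadius hn).comp (f := fun x : E n => ‖x‖⁻¹ • x) ?_
      fun x hx => inv_norm_smul_ne_zero hx
    exact (continuous_norm.continuousOn.inv₀ fun x hx => norm_ne_zero_iff.2 hx).smul continuousOn_id

/-- The point of the boundary on the ray through `y`. -/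
theorem smul_mem_frontier (hn : 2 ≤ n) (hD : StrictlyStarlike 0 D) {y : E n} (hy : y ≠ 0) :
    (Real.exp (logRadius D y) / ‖y‖) • y ∈ frontier D := by
  have := hD.polarRadius_smul_mem hn (inv_norm_smul_ne_zero hy)
  rwa [← hD.exp_logRadius hn hy, smul_smul] at this

theorem radialExt_eq_stretch (hn : 2 ≤ n) (hD : StrictlyStarlike 0 D) (a : ℝ) :
    radialExt D a = stretch a (logRadius D) := by
  ext1 x
  rcases eq_or_ne x 0 with rfl | hx
  · simp [radialExt, stretch]
  have hx' := norm_pos_iff.2 hx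
  rw [radialExt, if_neg hx, polarParam, ← hD.exp_logRadius hn hx, stretch, smul_smul, smul_smul,
    Real.rpow_def_of_pos hx']
  congr 1
  rw [show (a - 1) * Real.log ‖x‖ + logRadius D x = Real.log ‖x‖ * a + logRadius D x - Real.log ‖x‖
    by ring, Real.exp_sub, Real.exp_add, Real.exp_log hx']
  ring

theorem bddAbove_polarRadius (hn : 2 ≤ n) (hD : StrictlyStarlike 0 D) :
    BddAbove (range fun u : Metric.sphere (0 : E n) 1 => polarRadius D u) := by
  have := (isCompact_sphere (0 : E n) 1).bddAbove_image ((hD.continuousOn_polarRadius hn).mono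
    fun x hx h0 => by simp [mem_singleton_iff.1 h0] at hx)
  rwa [image_eq_range] at this

theorem bddBelow_polarRadius (hn : 2 ≤ n) (hD : StrictlyStarlike 0 D) :
    BddBelow (range fun u : Metric.sphere (0 : E n) 1 => polarRadius D u) :=
  ⟨0, by
    rintro _ ⟨u, rfl⟩
    exact (hD.polarRadius_pos hn fun h0 => by simpa [h0] using u.2).le⟩

theorem exp_logRadius_le_rMax (hn : 2 ≤ n) (hD : StrictlyStarlike 0 D) {x : E n} (hx : x ≠ 0) :
    Real.exp (logRadius D x) ≤ rMax D := by
  rw [hD.exp_logRadius hn hx]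
  exact le_ciSup (hD.bddAbove_polarRadius hn) ⟨‖x‖⁻¹ • x, by simp [norm_smul, hx]⟩

theorem rMin_le_exp_logRadius (hn : 2 ≤ n) (hD : StrictlyStarlike 0 D) {x : E n} (hx : x ≠ 0) :
    rMin D ≤ Real.exp (logRadius D x) := by
  rw [hD.exp_logRadius hn hx]
  exact ciInf_le (hD.bddBelow_polarRadius hn) ⟨‖x‖⁻¹ • x, by simp [norm_smul, hx]⟩

theorem nonempty_sphere (hn : 2 ≤ n) : Nonempty (Metric.sphere (0 : E n) 1) := by
  obtain ⟨w, hw, -⟩ := exists_ne_zero_inner_eq_zero hn 0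
  exact ⟨⟨‖w‖⁻¹ • w, by simp [norm_smul, hw]⟩⟩

theorem infDist_eq_rMin (hn : 2 ≤ n) (hD : StrictlyStarlike 0 D) :
    Metric.infDist 0 (frontier D) = rMin D := by
  have := nonempty_sphere hn
  have hmem : ∀ u : Metric.sphere (0 : E n) 1, polarRadius D u • (u : E n) ∈ frontier D ∧
      dist 0 (polarRadius D u • (u : E n)) = polarRadius D u := fun u => by
    have hu : (u : E n) ≠ 0 := fun h0 => by simpa [h0] using u.2
    have h1 : ‖(u : E n)‖ = 1 := by simp
    refine ⟨hD.polarRadius_smul_mem hn hu, ?_⟩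
    rw [dist_zero_left, norm_smul, h1, mul_one, Real.norm_of_nonneg (hD.polarRadius_pos hn hu).le]
  refine le_antisymm (le_ciInf fun u => ?_) ?_
  · exact (Metric.infDist_le_dist_of_mem (hmem u).1).trans_eq (hmem u).2
  · rw [Metric.le_infDist ⟨_, (hmem (Classical.arbitrary _)).1⟩]
    intro z hz
    have hz0 := hD.ne_zero_of_mem_frontier hn hz
    rw [dist_zero_left, ← Real.exp_log (norm_pos_iff.2 hz0), ← hD.logRadius_of_mem_frontier hn hz]
    exact hD.rMin_le_exp_logRadius hn hz0

theorem exists_frontier_exp_logRadius (hn : 2 ≤ n) (hD : StrictlyStarlike 0 D) {x : E n}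
    (hx : x ≠ 0) : ∃ z ∈ frontier D, ∃ t : ℝ, 0 < t ∧ x = t • z := by
  refine ⟨_, hD.smul_mem_frontier hn hx, ‖x‖ / Real.exp (logRadius D x),
    div_pos (norm_pos_iff.2 hx) (Real.exp_pos _), ?_⟩
  have := norm_ne_zero_iff.2 hx
  rw [smul_smul, div_mul_div_cancel₀ (Real.exp_pos _).ne', div_self this, one_smul]

theorem rMin_pos (hn : 2 ≤ n) (hD : StrictlyStarlike 0 D) : 0 < rMin D := by
  obtain ⟨B, hB⟩ := (hD.isAngular_logRadius hn).exists_bound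
  have := nonempty_sphere hn
  refine (Real.exp_pos (-B)).trans_le (le_ciInf fun u => ?_)
  have hu : (u : E n) ≠ 0 := fun h0 => by simpa [h0] using u.2
  have h1 : ‖(u : E n)‖ = 1 := by simp
  have h2 := hD.exp_logRadius hn hu
  rw [h1, inv_one, one_smul] at h2
  rw [← h2]
  exact Real.exp_le_exp.2 (abs_le.1 (hB _ hu)).1

end StrictlyStarlike
end RadialStretch

namespace RadialStretch

variable {n : ℕ} {D : Set (E n)}

/-! ### The tangent angle and the polar radius -/

theorem acuteAngle_nonneg (z x : E n) : 0 ≤ acuteAngle z x :=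
  le_min (InnerProductGeometry.angle_nonneg _ _)
    (sub_nonneg.2 (InnerProductGeometry.angle_le_pi _ _))

theorem acuteAngle_le (z x : E n) : acuteAngle z x ≤ Real.pi / 2 := by
  rcases le_total (InnerProductGeometry.angle (z - x) x) (Real.pi / 2) with h | h
  · exact (min_le_left _ _).trans h
  · exact (min_le_right _ _).trans (by linarith)

theorem cos_acuteAngle (z x : E n) :
    Real.cos (acuteAngle z x) = |Real.cos (InnerProductGeometry.angle (z - x) x)| := by
  have h0 := InnerProductGeometry.angle_nonneg (z - x) x
  have h1 := InnerProductGeometry.angle_le_pi (z - x) x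
  rcases le_total (InnerProductGeometry.angle (z - x) x) (Real.pi / 2) with h | h
  · rw [acuteAngle, min_eq_left (by linarith),
      abs_of_nonneg (Real.cos_nonneg_of_mem_Icc ⟨by linarith, h⟩)]
  · rw [acuteAngle, min_eq_right (by linarith), Real.cos_pi_sub,
      abs_of_nonpos (Real.cos_nonpos_of_pi_div_two_le_of_le h (by linarith [Real.pi_pos]))]

theorem le_acuteAngle_iff {z x : E n} (hx : x ≠ 0) (hz : z ≠ x) {β : ℝ} (h0 : 0 ≤ β)
    (h1 : β ≤ Real.pi / 2) :
    β ≤ acuteAngle z x ↔ |inner ℝ (z - x) x| ≤ Real.cos β * (‖z - x‖ * ‖x‖) := by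
  have hd : 0 < ‖z - x‖ * ‖x‖ :=
    mul_pos (norm_sub_pos_iff.2 hz) (norm_pos_iff.2 hx)
  have hpi := Real.pi_pos
  rw [← Real.strictAntiOn_cos.le_iff_ge ⟨acuteAngle_nonneg z x, by linarith [acuteAngle_le z x]⟩
    ⟨h0, by linarith⟩, cos_acuteAngle, InnerProductGeometry.cos_angle, abs_div, abs_of_pos hd,
    div_le_iff₀ hd]

/-- The component of `z` orthogonal to `x`. -/
noncomputable def perp (x z : E n) : E n := z - (inner ℝ x z / ‖x‖ ^ 2) • x

/-- Pythagoras for z - x relative to the direction x, cleared of denominators; z and z - x have the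
same component orthogonal to x. -/
theorem norm_sq_mul_eq {x : E n} (hx : x ≠ 0) (z : E n) :
    ‖z - x‖ ^ 2 * ‖x‖ ^ 2 = inner ℝ (z - x) x ^ 2 + ‖x‖ ^ 2 * ‖perp x z‖ ^ 2 := by
  have hx' := norm_ne_zero_iff.2 hx
  rw [perp, norm_sub_sq_real, norm_sub_sq_real, inner_sub_left, real_inner_self_eq_norm_sq,
    norm_smul, inner_smul_right, real_inner_comm x z, Real.norm_eq_abs, mul_pow, sq_abs]
  field_simp
  ring

theorem norm_perp_le {x : E n} (hx : x ≠ 0) (z : E n) : ‖perp x z‖ ≤ ‖z - x‖ := by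
  have hx' := norm_pos_iff.2 hx
  have h := norm_sq_mul_eq hx z
  refine abs_le_of_sq_le_sq' ?_ (norm_nonneg _) |>.2
  refine le_of_mul_le_mul_left ?_ (pow_pos hx' 2)
  nlinarith [sq_nonneg (inner ℝ (z - x) x)]

theorem perp_smul (x z : E n) (t : ℝ) : perp x (t • z) = t • perp x z := by
  rw [perp, perp, inner_smul_right, smul_sub, smul_smul, mul_div_assoc]

theorem isLittleO_log_norm {x : E n} (hx : x ≠ 0) {ε : ℝ} (hε : 0 < ε) :
    ∀ᶠ z in 𝓝 x, |Real.log ‖z‖ - Real.log ‖x‖ - inner ℝ (z - x) x / ‖x‖ ^ 2| ≤ ε * ‖z - x‖ := by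
  filter_upwards [(hasFDerivAt_log_norm hx).isLittleO.def hε] with z hz
  simpa [div_eq_inv_mul, real_inner_comm] using hz

namespace StrictlyStarlike

theorem tendsto_smul_frontier (hn : 2 ≤ n) (hD : StrictlyStarlike 0 D) {x : E n}
    (hx : x ∈ frontier D) :
    Tendsto (fun y => (Real.exp (logRadius D y) / ‖y‖) • y) (𝓝 x) (𝓝 x) := by
  have hx0 := hD.ne_zero_of_mem_frontier hn hx
  have hc : ContinuousAt (fun y => (Real.exp (logRadius D y) / ‖y‖) • y) x :=
    (((hD.isAngular_logRadius hn).continuousAt hx0).rexp.div continuous_norm.continuousAt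
      (norm_ne_zero_iff.2 hx0)).smul continuousAt_id
  have h1 : (Real.exp (logRadius D x) / ‖x‖) • x = x := by
    rw [hD.logRadius_of_mem_frontier hn hx, Real.exp_log (norm_pos_iff.2 hx0),
      div_self (norm_ne_zero_iff.2 hx0), one_smul]
  simpa only [ContinuousAt, h1] using hc

/-- Keeps the liminf from being taken along the trivial filter. Project x + tw with w ⟂ x radially
onto the boundary: the result tends to x, and its positive inner product with w separates it from x.
-/
theorem neBot_nhdsWithin_frontier (hn : 2 ≤ n) (hD : StrictlyStarlike 0 D) {x : E n}
    (hx : x ∈ frontier D) : (𝓝[frontier D \ {x}] x).NeBot := by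
  obtain ⟨w, hw, hxw⟩ := exists_ne_zero_inner_eq_zero hn x
  rw [← mem_closure_iff_nhdsWithin_neBot]
  have h1 : Tendsto (fun t : ℝ => x + t • w) (𝓝[>] 0) (𝓝 x) := by
    have : Continuous fun t : ℝ => x + t • w := by fun_prop
    simpa using (this.tendsto 0).mono_left nhdsWithin_le_nhds
  refine mem_closure_of_tendsto ((hD.tendsto_smul_frontier hn hx).comp h1) ?_
  have hx0 := hD.ne_zero_of_mem_frontier hn hx
  filter_upwards [self_mem_nhdsWithin] with t ht
  have hip : 0 < inner ℝ w (x + t • w) := by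
    rw [inner_add_right, inner_smul_right, real_inner_comm, hxw, zero_add,
      real_inner_self_eq_norm_sq]
    have := norm_pos_iff.2 hw
    have : (0 : ℝ) < t := ht
    positivity
  have hy : x + t • w ≠ 0 := fun h0 => by rw [h0, inner_zero_right] at hip; exact lt_irrefl _ hip
  refine ⟨hD.smul_mem_frontier hn hy, fun heq => ?_⟩
  have h2 : inner ℝ w ((Real.exp (logRadius D (x + t • w)) / ‖x + t • w‖) • (x + t • w)) = 0 := by
    have heq' : (Real.exp (logRadius D (x + t • w)) / ‖x + t • w‖) • (x + t • w) = x := heq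
    rw [heq', real_inner_comm, hxw]
  rw [inner_smul_right] at h2
  have := norm_pos_iff.2 hy
  have h3 : 0 < Real.exp (logRadius D (x + t • w)) / ‖x + t • w‖ := by positivity
  exact (mul_pos h3 hip).ne' h2

theorem le_tangentAngle_iff_eventually (hn : 2 ≤ n) (hD : StrictlyStarlike 0 D) {x : E n}
    (hx : x ∈ frontier D) {α : ℝ} : α ≤ tangentAngle D x ↔
      ∀ β < α, ∀ᶠ z in 𝓝[frontier D \ {x}] x, β ≤ acuteAngle z x := by
  have := hD.neBot_nhdsWithin_frontier hn hx
  exact le_liminf_iff'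
    (isBoundedUnder_of ⟨Real.pi / 2, fun z => acuteAngle_le z x⟩).isCoboundedUnder_ge
    (isBoundedUnder_of ⟨0, fun z => acuteAngle_nonneg z x⟩)

theorem tangentAngle_le (hn : 2 ≤ n) (hD : StrictlyStarlike 0 D) {x : E n}
    (hx : x ∈ frontier D) : tangentAngle D x ≤ Real.pi / 2 := by
  by_contra! h
  obtain ⟨β, hβ, hβ'⟩ := exists_between h
  have := hD.neBot_nhdsWithin_frontier hn hx
  obtain ⟨z, hz⟩ := ((hD.le_tangentAngle_iff_eventually hn hx).1 le_rfl β hβ').exists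
  linarith [acuteAngle_le z x]

/-- For y near x let z be the boundary point on its ray, so ψ(y) = log|z|. An angle at least β
bounds the radial part of z - x by cos β |z - x|, and |z - x| by |`perp x z`|/sin β. Hence log|z| -
log|x| is at most about cot β/|x| times |`perp x z`|, which is about |`perp x y`| ≤ |y - x|. -/
theorem pointwiseLip_of_le_tangentAngle (hn : 2 ≤ n) (hD : StrictlyStarlike 0 D) {x : E n}
    (hx : x ∈ frontier D) {α : ℝ} (h0 : 0 < α) (h1 : α ≤ Real.pi / 2)
    (h : α ≤ tangentAngle D x) : PointwiseLip (logRadius D) x (Real.cot α / ‖x‖) := by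
  intro k hk
  have hx0 := hD.ne_zero_of_mem_frontier hn hx
  have hR := norm_pos_iff.2 hx0
  have hlx := hD.logRadius_of_mem_frontier hn hx
  -- choose `β < α`, `ε` and `η` with `(cot β / |x| + ε / sin β) (1 + η) < k`
  have hcot : ContinuousAt (fun β => Real.cos β / Real.sin β / ‖x‖) α :=
    (Real.continuous_cos.continuousAt.div Real.continuous_sin.continuousAt
      (Real.sin_pos_of_pos_of_lt_pi h0 (by linarith [Real.pi_pos])).ne').div_const _
  rw [Real.cot_eq_cos_div_sin] at hk
  obtain ⟨β, hβ, hβ0, hβα⟩ : ∃ β, Real.cos β / Real.sin β / ‖x‖ < k ∧ 0 < β ∧ β < α := by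
    have h2 : ∀ᶠ β in 𝓝[<] α, Real.cos β / Real.sin β / ‖x‖ < k :=
      (hcot.eventually (gt_mem_nhds hk)).filter_mono nhdsWithin_le_nhds
    exact (h2.and ((eventually_nhdsWithin_of_eventually_nhds (lt_mem_nhds h0)).and
      self_mem_nhdsWithin)).exists
  have hs : 0 < Real.sin β := Real.sin_pos_of_pos_of_lt_pi hβ0 (by linarith [Real.pi_pos])
  have hc : 0 ≤ Real.cos β := Real.cos_nonneg_of_mem_Icc ⟨by linarith, by linarith⟩
  set l := Real.cos β / Real.sin β / ‖x‖ with hl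
  have hl0 : 0 ≤ l := by positivity
  obtain ⟨k', hk1, hk2⟩ := exists_between hβ
  have hev := (hD.le_tangentAngle_iff_eventually hn hx).1 h β hβα
  rw [eventually_nhdsWithin_iff] at hev
  -- With tolerance (k' - l) sin β, the first-order term l sin β |z - x| and the error add up to
  -- exactly k' sin β |z - x|.
  have hlog := isLittleO_log_norm hx0 (mul_pos (sub_pos.2 hk1) hs)
  have hP := hD.tendsto_smul_frontier hn hx
  have hscale : ∀ᶠ y in 𝓝 x, Real.exp (logRadius D y) / ‖y‖ < k / k' := by
    have hc : ContinuousAt (fun y => Real.exp (logRadius D y) / ‖y‖) x :=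
      ((hD.isAngular_logRadius hn).continuousAt hx0).rexp.div continuous_norm.continuousAt hR.ne'
    refine hc.eventually (gt_mem_nhds ?_)
    dsimp only
    rw [hlx, Real.exp_log hR, div_self hR.ne', one_lt_div (by linarith)]
    exact hk2
  filter_upwards [hP.eventually hev, hP.eventually hlog, hscale,
    isOpen_compl_singleton.mem_nhds hx0] with y hy1 hy2 hy3 hy0
  have hzf := hD.smul_mem_frontier hn hy0
  have hsc : 0 < Real.exp (logRadius D y) / ‖y‖ := div_pos (Real.exp_pos _) (norm_pos_iff.2 hy0)
  have hlz := hD.logRadius_of_mem_frontier hn hzf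
  rw [(hD.isAngular_logRadius hn).smul _ _ hsc] at hlz
  have hperp : ‖perp x ((Real.exp (logRadius D y) / ‖y‖) • y)‖ ≤ k / k' * ‖y - x‖ := by
    rw [perp_smul, norm_smul, Real.norm_of_nonneg hsc.le]
    exact mul_le_mul hy3.le (norm_perp_le hx0 y) (norm_nonneg _) (by
      have : 0 < k' := by linarith
      have : 0 < k := by linarith
      positivity)
  set z := (Real.exp (logRadius D y) / ‖y‖) • y
  rw [hlz, hlx, Real.norm_eq_abs]
  rcases eq_or_ne z x with hzx | hzx
  · rw [hzx, sub_self, abs_zero]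
    have : 0 < k := by linarith
    positivity
  have hA := (le_acuteAngle_iff hx0 hzx hβ0.le (by linarith)).1 (hy1 ⟨hzf, hzx⟩)
  have hsq := norm_sq_mul_eq hx0 z
  have hcs := Real.sin_sq_add_cos_sq β
  have hA2 : inner ℝ (z - x) x ^ 2 ≤ (Real.cos β * (‖z - x‖ * ‖x‖)) ^ 2 := by
    rw [← sq_abs]; exact pow_le_pow_left₀ (abs_nonneg _) hA 2
  -- `|z - x| ≤ |w| / sin β` for the orthogonal component `w`
  have hd : Real.sin β * ‖z - x‖ ≤ ‖perp x z‖ := by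
    refine abs_le_of_sq_le_sq' ?_ (norm_nonneg _) |>.2
    refine le_of_mul_le_mul_left ?_ (pow_pos hR 2)
    have : (Real.sin β * ‖z - x‖) ^ 2 = ‖z - x‖ ^ 2 - (Real.cos β * ‖z - x‖) ^ 2 := by
      rw [mul_pow, mul_pow]; linear_combination ‖z - x‖ ^ 2 * hcs
    rw [this]
    nlinarith
  have hA3 : |inner ℝ (z - x) x / ‖x‖ ^ 2| ≤ l * (Real.sin β * ‖z - x‖) := by
    rw [abs_div, abs_of_pos (pow_pos hR 2), div_le_iff₀ (pow_pos hR 2)]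
    refine hA.trans_eq ?_
    rw [hl]; field_simp
  have h3 : |Real.log ‖z‖ - Real.log ‖x‖| ≤ k' * (Real.sin β * ‖z - x‖) := by
    have := abs_sub_abs_le_abs_sub (Real.log ‖z‖ - Real.log ‖x‖) (inner ℝ (z - x) x / ‖x‖ ^ 2)
    calc |Real.log ‖z‖ - Real.log ‖x‖| ≤ (k' - l) * Real.sin β * ‖z - x‖ +
          l * (Real.sin β * ‖z - x‖) := by linarith
      _ = _ := by ring
  have hk' : 0 < k' := by linarith
  calc _ ≤ k' * (Real.sin β * ‖z - x‖) := h3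
    _ ≤ k' * (k / k' * ‖y - x‖) := mul_le_mul_of_nonneg_left (hd.trans hperp) hk'.le
    _ = k * ‖y - x‖ := by field_simp

/-- For a boundary point z, apply the bound on ψ at the point of its ray in the hyperplane through x
orthogonal to x. Its displacement from x is a multiple, close to 1, of `perp x z`. An angle below β
would make the radial part of z - x too large for this bound. -/
theorem le_tangentAngle_of_pointwiseLip (hn : 2 ≤ n) (hD : StrictlyStarlike 0 D) {x : E n}
    (hx : x ∈ frontier D) {α : ℝ} (h0 : 0 < α) (h1 : α ≤ Real.pi / 2)
    (h : PointwiseLip (logRadius D) x (Real.cot α / ‖x‖)) : α ≤ tangentAngle D x := by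
  rw [hD.le_tangentAngle_iff_eventually hn hx]
  intro β₀ hβ₀
  have hx0 := hD.ne_zero_of_mem_frontier hn hx
  have hR := norm_pos_iff.2 hx0
  have hlx := hD.logRadius_of_mem_frontier hn hx
  obtain ⟨β, hβ, hβα⟩ := exists_between (max_lt hβ₀ h0)
  have hβ0 : 0 < β := (le_max_right _ _).trans_lt hβ
  have hs : 0 < Real.sin β := Real.sin_pos_of_pos_of_lt_pi hβ0 (by linarith [Real.pi_pos])
  have hsα : 0 < Real.sin α := Real.sin_pos_of_pos_of_lt_pi h0 (by linarith [Real.pi_pos])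
  have hcα : 0 ≤ Real.cos α := Real.cos_nonneg_of_mem_Icc ⟨by linarith, by linarith⟩
  have hcot : Real.cot α < Real.cos β / Real.sin β := by
    rw [Real.cot_eq_cos_div_sin, div_lt_div_iff₀ hsα hs]
    have : 0 < Real.sin (α - β) :=
      Real.sin_pos_of_pos_of_lt_pi (by linarith) (by linarith [Real.pi_pos])
    rw [Real.sin_sub] at this
    linarith
  have hcot0 : 0 ≤ Real.cot α := by rw [Real.cot_eq_cos_div_sin]; positivity
  -- The gap between cot α and cot β is split in three: m₁ absorbs the slack in the pointwise bound,
  -- m₂/m₁ the scaling factor, and cot β - m₂ the error of the logarithm.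
  obtain ⟨m₁, hm1, hm1'⟩ := exists_between hcot
  obtain ⟨m₂, hm2, hm2'⟩ := exists_between hm1'
  have hm1p : 0 < m₁ := by linarith
  have hε : 0 < (Real.cos β / Real.sin β - m₂) * Real.sin β / ‖x‖ :=
    div_pos (mul_pos (by linarith) hs) hR
  have hy : ∀ᶠ y in 𝓝 x, ‖logRadius D y - logRadius D x‖ ≤ m₁ / ‖x‖ * ‖y - x‖ :=
    h _ (div_lt_div_of_pos_right hm1 hR)
  have hxx : inner ℝ x x = ‖x‖ ^ 2 := real_inner_self_eq_norm_sq x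
  have hipc : ContinuousAt (fun z : E n => ‖x‖ ^ 2 / inner ℝ x z) x :=
    continuousAt_const.div (by fun_prop) (by rw [hxx]; positivity)
  have hlim : Tendsto (fun z : E n => (‖x‖ ^ 2 / inner ℝ x z) • z) (𝓝 x) (𝓝 x) := by
    have : ContinuousAt (fun z : E n => (‖x‖ ^ 2 / inner ℝ x z) • z) x := hipc.smul continuousAt_id
    simpa [ContinuousAt, hx0] using this
  have hip : ∀ᶠ z in 𝓝 x, ‖x‖ ^ 2 / inner ℝ x z < m₂ / m₁ := by
    refine hipc.eventually (gt_mem_nhds ?_)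
    dsimp only
    rw [hxx, div_self (by positivity), one_lt_div hm1p]
    exact hm2
  have hip0 : ∀ᶠ z in 𝓝 x, 0 < inner ℝ x z := by
    have : ContinuousAt (fun z : E n => inner ℝ x z) x := by fun_prop
    refine this.eventually (lt_mem_nhds ?_)
    dsimp only
    rw [hxx]; positivity
  rw [eventually_nhdsWithin_iff]
  filter_upwards [hlim.eventually hy, hip, hip0, isLittleO_log_norm hx0 hε]
    with z hz1 hz2 hz3 hz4 hzm
  refine ((le_max_left _ _).trans hβ.le).trans
    ((le_acuteAngle_iff hx0 hzm.2 hβ0.le (by linarith)).2 ?_)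
  have hr : 0 < ‖x‖ ^ 2 / inner ℝ x z := by positivity
  rw [(hD.isAngular_logRadius hn).smul _ _ hr, hlx, hD.logRadius_of_mem_frontier hn hzm.1,
    Real.norm_eq_abs] at hz1
  have hyx : (‖x‖ ^ 2 / inner ℝ x z) • z - x = (‖x‖ ^ 2 / inner ℝ x z) • perp x z := by
    rw [perp, smul_sub, smul_smul, div_mul_div_cancel₀ hz3.ne', div_self (by positivity), one_smul]
  rw [hyx, norm_smul, Real.norm_of_nonneg hr.le] at hz1
  by_contra! hlt
  have hd0 : 0 < ‖z - x‖ := norm_sub_pos_iff.2 hzm.2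
  have hcβ : 0 ≤ Real.cos β := Real.cos_nonneg_of_mem_Icc ⟨by linarith, by linarith⟩
  have hsq := norm_sq_mul_eq hx0 z
  have hcs := Real.sin_sq_add_cos_sq β
  have hA2 : (Real.cos β * (‖z - x‖ * ‖x‖)) ^ 2 ≤ inner ℝ (z - x) x ^ 2 := by
    rw [← sq_abs (inner ℝ (z - x) x)]; exact pow_le_pow_left₀ (by positivity) hlt.le 2
  have hw : ‖perp x z‖ ≤ Real.sin β * ‖z - x‖ := by
    refine abs_le_of_sq_le_sq' ?_ (by positivity) |>.2
    refine le_of_mul_le_mul_left ?_ (pow_pos hR 2)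
    have : (Real.sin β * ‖z - x‖) ^ 2 = ‖z - x‖ ^ 2 - (Real.cos β * ‖z - x‖) ^ 2 := by
      rw [mul_pow, mul_pow]; linear_combination ‖z - x‖ ^ 2 * hcs
    rw [this]
    nlinarith
  have hA : |inner ℝ (z - x) x / ‖x‖ ^ 2| ≤ m₂ / ‖x‖ * (Real.sin β * ‖z - x‖) +
      (Real.cos β / Real.sin β - m₂) * Real.sin β / ‖x‖ * ‖z - x‖ := by
    have h2 := abs_sub_abs_le_abs_sub (inner ℝ (z - x) x / ‖x‖ ^ 2) (Real.log ‖z‖ - Real.log ‖x‖)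
    have h5 := abs_sub_comm (inner ℝ (z - x) x / ‖x‖ ^ 2) (Real.log ‖z‖ - Real.log ‖x‖)
    have hm2p : 0 < m₂ := hm1p.trans hm2
    have h3 : m₁ / ‖x‖ * (‖x‖ ^ 2 / inner ℝ x z * ‖perp x z‖) ≤
        m₁ / ‖x‖ * (m₂ / m₁ * (Real.sin β * ‖z - x‖)) := by gcongr
    have h4 : m₁ / ‖x‖ * (m₂ / m₁ * (Real.sin β * ‖z - x‖)) =
        m₂ / ‖x‖ * (Real.sin β * ‖z - x‖) := by field_simp
    linarith
  have hA' : m₂ / ‖x‖ * (Real.sin β * ‖z - x‖) +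
      (Real.cos β / Real.sin β - m₂) * Real.sin β / ‖x‖ * ‖z - x‖ =
      Real.cos β * (‖z - x‖ * ‖x‖) / ‖x‖ ^ 2 := by field_simp; ring
  rw [hA', abs_div, abs_of_pos (pow_pos hR 2), div_le_div_iff_of_pos_right (pow_pos hR 2)] at hA
  linarith

end StrictlyStarlike
end RadialStretch

namespace RadialStretch

variable {n : ℕ} {D : Set (E n)}

theorem lip_le_of_lipschitzWith {X Y : Type*} [PseudoEMetricSpace X] [PseudoEMetricSpace Y]
    {f : X → Y} {K : ℝ≥0} (h : LipschitzWith K f) : lip f ≤ K :=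
  iInf₂_le (f := fun (L : ℝ≥0) (_ : LipschitzWith L f) => (L : ℝ≥0∞)) K h

/-! ### Trigonometry -/

theorem cot_nonneg_of_le {α : ℝ} (h0 : 0 < α) (h1 : α ≤ Real.pi / 2) : 0 ≤ Real.cot α := by
  rw [Real.cot_eq_cos_div_sin]
  exact div_nonneg (Real.cos_nonneg_of_mem_Icc ⟨by linarith, h1⟩)
    (Real.sin_pos_of_pos_of_lt_pi h0 (by linarith [Real.pi_pos])).le

theorem cot_eq_tan (α : ℝ) : Real.cot α = Real.tan (Real.pi / 2 - α) := by
  rw [Real.cot_eq_cos_div_sin, Real.tan_eq_sin_div_cos, Real.sin_pi_div_two_sub,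
    Real.cos_pi_div_two_sub]

theorem exists_cot_eq {m : ℝ} (hm : 0 ≤ m) : ∃ α, 0 < α ∧ α ≤ Real.pi / 2 ∧ Real.cot α = m := by
  refine ⟨Real.pi / 2 - Real.arctan m, by linarith [Real.arctan_lt_pi_div_two m],
    by linarith [Real.arctan_nonneg.2 hm], ?_⟩
  rw [cot_eq_tan, sub_sub_cancel, Real.tan_arctan]

theorem arctan_cot {α : ℝ} (h0 : 0 < α) (h1 : α ≤ Real.pi / 2) :
    Real.arctan (Real.cot α) = Real.pi / 2 - α := by
  rw [cot_eq_tan, Real.arctan_tan (by linarith [Real.pi_pos]) (by linarith)]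

theorem cot_le_cot_iff {α β : ℝ} (hα : 0 < α) (hα' : α ≤ Real.pi / 2) (hβ : 0 < β)
    (hβ' : β ≤ Real.pi / 2) : Real.cot α ≤ Real.cot β ↔ β ≤ α := by
  rw [← Real.arctan_strictMono.le_iff_le, arctan_cot hα hα', arctan_cot hβ hβ', sub_le_sub_iff_left]

theorem csc_sq {α : ℝ} (h0 : 0 < α) (h1 : α ≤ Real.pi / 2) : csc α ^ 2 = 1 + Real.cot α ^ 2 := by
  have hs := (Real.sin_pos_of_pos_of_lt_pi h0 (by linarith [Real.pi_pos])).ne'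
  rw [csc, Real.cot_eq_cos_div_sin]
  field_simp
  linarith [Real.sin_sq_add_cos_sq α]

theorem csc_pos {α : ℝ} (h0 : 0 < α) (h1 : α ≤ Real.pi / 2) : 0 < csc α :=
  one_div_pos.2 (Real.sin_pos_of_pos_of_lt_pi h0 (by linarith [Real.pi_pos]))

theorem lipFactor_eq {α : ℝ} (h0 : 0 < α) (h1 : α ≤ Real.pi / 2) :
    lipFactor α = singMax 1 (Real.cot α) := by
  rw [lipFactor, csc_sq h0 h1, singMax, add_comm]
  ring_nf

theorem qcK_eq (a α : ℝ) : qcK a α = singMax a (Real.cot α) ^ 2 / a := by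
  rw [qcK, singMax, add_comm 1 a, add_comm (√((a - 1) ^ 2 + _))]
  ring

theorem one_le_cot_half {α : ℝ} (h0 : 0 < α) (h1 : α ≤ Real.pi / 2) : 1 ≤ Real.cot (α / 2) := by
  have hs := Real.sin_pos_of_pos_of_lt_pi (half_pos h0) (by linarith [Real.pi_pos])
  have hc := Real.cos_nonneg_of_mem_Icc (x := α / 2) ⟨by linarith, by linarith [Real.pi_pos]⟩
  have hcα := Real.cos_nonneg_of_mem_Icc (x := α) ⟨by linarith, h1⟩
  rw [Real.cot_eq_cos_div_sin, one_le_div hs]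
  rw [show α = 2 * (α / 2) by ring, Real.cos_two_mul'] at hcα
  exact abs_le_of_sq_le_sq' (by linarith) hc |>.2

theorem cot_half_add_inv {α : ℝ} (h0 : 0 < α) (h1 : α ≤ Real.pi / 2) :
    Real.cot (α / 2) + 1 / Real.cot (α / 2) = 2 * csc α := by
  have hs := (Real.sin_pos_of_pos_of_lt_pi (half_pos h0) (by linarith [Real.pi_pos])).ne'
  have hc := (Real.cos_pos_of_mem_Ioo (x := α / 2) ⟨by linarith, by linarith [Real.pi_pos]⟩).ne'
  rw [csc, show Real.sin α = 2 * Real.sin (α / 2) * Real.cos (α / 2) by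
    rw [← Real.sin_two_mul]; ring_nf, Real.cot_eq_cos_div_sin]
  field_simp
  linarith [Real.sin_sq_add_cos_sq (α / 2)]

/-- Since t + 1/t is increasing on [1, ∞), dilatations can be compared through K + 1/K, which is
free of square roots. -/
theorem le_of_add_inv_le {K K' : ℝ} (h : 1 ≤ K) (h' : 1 ≤ K') (hK : K + 1 / K ≤ K' + 1 / K') :
    K ≤ K' := by
  by_contra! hlt
  have h2 : K + 1 / K - (K' + 1 / K') = (K - K') * (K * K' - 1) / (K * K') := by
    field_simp; ring
  have h3 : 0 < (K - K') * (K * K' - 1) / (K * K') :=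
    div_pos (mul_pos (by linarith) (by nlinarith)) (by positivity)
  linarith

theorem one_le_qcK {a : ℝ} (ha : 0 < a) (α : ℝ) : 1 ≤ qcK a α := by
  rw [qcK_eq, one_le_div ha]
  nlinarith [le_singMax a (Real.cot α), one_le_singMax a (Real.cot α)]

/-- With K = S²/a, this is the characteristic equation of S² divided by aS². -/
theorem qcK_add_inv {a α : ℝ} (ha : 0 < a) (h0 : 0 < α) (h1 : α ≤ Real.pi / 2) :
    qcK a α + 1 / qcK a α = (a ^ 2 + csc α ^ 2) / a := by
  have h := singMax_sq a (Real.cot α)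
  have hs := (singMax_pos ha (Real.cot α)).ne'
  rw [qcK_eq, csc_sq h0 h1]
  field_simp
  linear_combination h

theorem qcK_csc {α : ℝ} (h0 : 0 < α) (h1 : α ≤ Real.pi / 2) :
    qcK (csc α) α = Real.cot (α / 2) := by
  have hc := csc_pos h0 h1
  have h : qcK (csc α) α + 1 / qcK (csc α) α = Real.cot (α / 2) + 1 / Real.cot (α / 2) := by
    rw [qcK_add_inv hc h0 h1, cot_half_add_inv h0 h1]
    field_simp
    ring
  exact le_antisymm (le_of_add_inv_le (one_le_qcK hc α) (one_le_cot_half h0 h1) h.le)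
    (le_of_add_inv_le (one_le_cot_half h0 h1) (one_le_qcK hc α) h.ge)

theorem qcK_csc_le {a α : ℝ} (ha : 0 < a) (h0 : 0 < α) (h1 : α ≤ Real.pi / 2) :
    qcK (csc α) α ≤ qcK a α := by
  have hc := csc_pos h0 h1
  refine le_of_add_inv_le (one_le_qcK hc α) (one_le_qcK ha α) ?_
  rw [qcK_add_inv hc h0 h1, qcK_add_inv ha h0 h1, div_le_div_iff₀ hc ha]
  -- This is a + csc²α/a ≥ 2 csc α, with equality at a = csc α.
  nlinarith [mul_nonneg hc.le (sq_nonneg (a - csc α))]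

/-! ### The tangent condition on all rays -/

theorem PointwiseLip.smul_of_isAngular {ψ : E n → ℝ} (hψ : IsAngular ψ) {x : E n} {m t : ℝ}
    (ht : 0 < t) (h : PointwiseLip ψ x (m / ‖x‖)) : PointwiseLip ψ (t • x) (m / ‖t • x‖) := by
  intro k hk
  rw [norm_smul, Real.norm_of_nonneg ht.le, gt_iff_lt, div_mul_eq_div_div_swap, div_lt_iff₀ ht] at hk
  have h1 : Tendsto (fun y : E n => t⁻¹ • y) (𝓝 (t • x)) (𝓝 x) := by
    have : Continuous fun y : E n => t⁻¹ • y := by fun_prop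
    simpa [smul_smul, ht.ne'] using this.tendsto (t • x)
  filter_upwards [h1.eventually (h _ hk)] with y hy
  rw [hψ.smul y _ (inv_pos.2 ht)] at hy
  rw [hψ.smul x t ht]
  refine hy.trans_eq ?_
  rw [mul_assoc, ← Real.norm_of_nonneg ht.le, ← norm_smul, smul_sub, smul_smul,
    Real.norm_of_nonneg ht.le, mul_inv_cancel₀ ht.ne', one_smul]

namespace StrictlyStarlike

theorem tangentCondition_iff (hn : 2 ≤ n) (hD : StrictlyStarlike 0 D) {α : ℝ} (h0 : 0 < α)
    (h1 : α ≤ Real.pi / 2) : TangentCondition D α ↔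
      ∀ x, x ≠ 0 → PointwiseLip (logRadius D) x (Real.cot α / ‖x‖) := by
  constructor
  · rintro ⟨-, h⟩ x hx
    obtain ⟨z, hz, t, ht, rfl⟩ := hD.exists_frontier_exp_logRadius hn hx
    exact (hD.pointwiseLip_of_le_tangentAngle hn hz h0 h1 (h z hz)).smul_of_isAngular
      (hD.isAngular_logRadius hn) ht
  · exact fun h => ⟨⟨h0, h1⟩, fun x hx => hD.le_tangentAngle_of_pointwiseLip hn hx h0 h1
      (h x (hD.ne_zero_of_mem_frontier hn hx))⟩

theorem exists_tangentCondition (hn : 2 ≤ n) (hD : StrictlyStarlike 0 D) {m : ℝ} (hm : 0 ≤ m)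
    (h : ∀ x, x ≠ 0 → PointwiseLip (logRadius D) x (m / ‖x‖)) :
    ∃ α, Real.cot α = m ∧ TangentCondition D α := by
  obtain ⟨α, h0, h1, rfl⟩ := exists_cot_eq hm
  exact ⟨α, rfl, (hD.tangentCondition_iff hn h0 h1).2 h⟩

theorem exp_logRadius_of_mem_frontier (hn : 2 ≤ n) (hD : StrictlyStarlike 0 D) {x : E n}
    (hx : x ∈ frontier D) : Real.exp (logRadius D x) = ‖x‖ := by
  rw [hD.logRadius_of_mem_frontier hn hx,
    Real.exp_log (norm_pos_iff.2 (hD.ne_zero_of_mem_frontier hn hx))]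

/-! ### Lipschitz constants -/

/-- The form with χ covers ψ and -ψ, hence the map and its inverse. The upper bound uses the best
slope cot α(x) on each ray. For the lower bound, a smaller Lipschitz constant would allow a slope m
< cot α(x), that is, a tangent angle at x larger than α(x). -/
theorem lip_stretch_one (hn : 2 ≤ n) (hD : StrictlyStarlike 0 D) {α : ℝ}
    (hα : TangentCondition D α) {χ : E n → ℝ} (hχ : IsAngular χ)
    (hχD : ∀ x k, PointwiseLip χ x k ↔ PointwiseLip (logRadius D) x k) :
    lip (stretch 1 χ) = ⨆ x : frontier D,
      ENNReal.ofReal (Real.exp (χ x) * lipFactor (tangentAngle D x)) := by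
  obtain ⟨⟨h0, h1⟩, hα'⟩ := hα
  have hpos : ∀ z ∈ frontier D, 0 < tangentAngle D z := fun z hz => h0.trans_le (hα' z hz)
  refine le_antisymm ?_ (iSup_le fun x => le_iInf₂ fun K hK => ?_)
  · set S := ⨆ x : frontier D, ENNReal.ofReal (Real.exp (χ x) * lipFactor (tangentAngle D x))
      with hS
    rcases eq_or_ne S ⊤ with htop | htop
    · rw [htop]; exact le_top
    · have hL : LipschitzWith S.toReal.toNNReal (stretch 1 χ) := by
        refine lipschitzWith_stretch_one hn hχ (cot_nonneg_of_le h0 h1) (fun x hx => (hχD _ _).2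
          ((hD.tangentCondition_iff hn h0 h1).1 ⟨⟨h0, h1⟩, hα'⟩ x hx)) (fun x hx => ?_)
          ENNReal.toReal_nonneg
        obtain ⟨z, hz, t, ht, rfl⟩ := hD.exists_frontier_exp_logRadius hn hx
        have hz1 := hD.tangentAngle_le hn hz
        refine ⟨Real.cot (tangentAngle D z), cot_nonneg_of_le (hpos z hz) hz1,
          (hχD _ _).2 ?_, ?_⟩
        · exact (hD.pointwiseLip_of_le_tangentAngle hn hz (hpos z hz) hz1 le_rfl).smul_of_isAngular
            (hD.isAngular_logRadius hn) ht
        · rw [hχ.smul z t ht, ← lipFactor_eq (hpos z hz) hz1,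
            ← ENNReal.ofReal_le_iff_le_toReal htop]
          exact le_iSup (fun x : frontier D =>
            ENNReal.ofReal (Real.exp (χ x) * lipFactor (tangentAngle D x))) ⟨z, hz⟩
      exact (lip_le_of_lipschitzWith hL).trans_eq (ENNReal.ofReal_toReal htop)
  · obtain ⟨z, hz⟩ := x
    have hz0 := hD.ne_zero_of_mem_frontier hn hz
    have hz1 := hD.tangentAngle_le hn hz
    refine ENNReal.ofReal_le_of_le_toReal ?_
    rw [ENNReal.coe_toReal, lipFactor_eq (hpos z hz) hz1]
    dsimp only
    by_contra! hlt
    have hcot0 := cot_nonneg_of_le (hpos z hz) hz1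
    -- For cot α(x) = 0 there is no smaller slope m ≥ 0; there C(α(x)) = 1, and comparison with the
    -- origin gives e^χ(x) ≤ K.
    rcases hcot0.eq_or_lt with hcot | hcot
    · have h2 := exp_le_of_lipschitzWith hK hz0
      have h3 : singMax 1 (Real.cot (tangentAngle D z)) = 1 := by
        rw [← hcot, singMax]
        norm_num
      rw [h3] at hlt
      linarith
    · have hcont : ContinuousAt (fun m => Real.exp (χ z) * singMax 1 m)
          (Real.cot (tangentAngle D z)) := (continuous_const.mul (continuous_singMax 1)).continuousAt
      obtain ⟨m, hm1, hm0, hm2⟩ := ((hcont.eventually (lt_mem_nhds hlt)).filter_mono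
        nhdsWithin_le_nhds |>.and ((eventually_nhdsWithin_of_eventually_nhds
          (lt_mem_nhds hcot)).and self_mem_nhdsWithin)).exists
            (f := 𝓝[<] (Real.cot (tangentAngle D z)))
      have hP := (hχD _ _).1 (pointwiseLip_of_lipschitzWith hn hχ hK hz0 hm0.le hm1)
      obtain ⟨γ, hγ0, hγ1, rfl⟩ := exists_cot_eq hm0.le
      have h4 := hD.le_tangentAngle_of_pointwiseLip hn hz hγ0 hγ1 hP
      rw [← cot_le_cot_iff (hpos z hz) hz1 hγ0 hγ1] at h4
      exact (mem_Iio.1 hm2).not_ge h4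

theorem lipschitzWith_of_tangentCondition (hn : 2 ≤ n) (hD : StrictlyStarlike 0 D) {α : ℝ}
    (hα : TangentCondition D α) {χ : E n → ℝ} (hχ : IsAngular χ)
    (hχD : ∀ x k, PointwiseLip χ x k ↔ PointwiseLip (logRadius D) x k) {M : ℝ} (hM : 0 ≤ M)
    (hχM : ∀ x, x ≠ 0 → Real.exp (χ x) ≤ M) :
    LipschitzWith (M * lipFactor α).toNNReal (stretch 1 χ) := by
  have hα' := hα.1
  have hcot := cot_nonneg_of_le hα'.1 hα'.2
  have hP := fun x hx => (hχD _ _).2 ((hD.tangentCondition_iff hn hα'.1 hα'.2).1 hα x hx)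
  have hs := singMax_pos one_pos (Real.cot α)
  rw [lipFactor_eq hα'.1 hα'.2]
  refine lipschitzWith_stretch_one hn hχ hcot hP (fun x hx => ⟨_, hcot, hP x hx, ?_⟩)
    (mul_nonneg hM hs.le)
  exact mul_le_mul_of_nonneg_right (hχM x hx) hs.le

theorem pointwiseLip_neg_iff {ψ : E n → ℝ} (x : E n) (k : ℝ) :
    PointwiseLip (fun y => -ψ y) x k ↔ PointwiseLip ψ x k :=
  ⟨fun h => by simpa using h.neg, fun h => h.neg⟩

theorem rMax_pos (hn : 2 ≤ n) (hD : StrictlyStarlike 0 D) : 0 < rMax D := by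
  obtain ⟨v, -, hv⟩ := hD.exists_ne_zero_mem hn
  exact (Real.exp_pos _).trans_le (hD.exp_logRadius_le_rMax hn hv)

theorem lipschitzWith_lipL1 (hn : 2 ≤ n) (hD : StrictlyStarlike 0 D) {α : ℝ}
    (hα : TangentCondition D α) :
    LipschitzWith (lipL1 D α).toNNReal (stretch 1 (logRadius D)) :=
  hD.lipschitzWith_of_tangentCondition hn hα (hD.isAngular_logRadius hn) (fun _ _ => Iff.rfl)
    (hD.rMax_pos hn).le fun _ hx => hD.exp_logRadius_le_rMax hn hx

theorem lipschitzWith_lipL2 (hn : 2 ≤ n) (hD : StrictlyStarlike 0 D) {α : ℝ}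
    (hα : TangentCondition D α) :
    LipschitzWith (lipL2 D α).toNNReal (stretch 1 fun y => -logRadius D y) :=
  hD.lipschitzWith_of_tangentCondition hn hα (hD.isAngular_logRadius hn).neg
    pointwiseLip_neg_iff (one_div_pos.2 (hD.rMin_pos hn)).le fun x hx => by
      rw [Real.exp_neg, ← one_div]
      exact one_div_le_one_div_of_le (hD.rMin_pos hn) (hD.rMin_le_exp_logRadius hn hx)

theorem stretchHomeomorph_symm_one {ψ : E n → ℝ} (h : IsAngular ψ) :
    ⇑(stretchHomeomorph one_pos h).symm = stretch 1 fun y => -ψ y := by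
  change stretch 1⁻¹ (fun y => -(1⁻¹ * ψ y)) = _
  simp

theorem isBiLipschitzWith_lipL (hn : 2 ≤ n) (hD : StrictlyStarlike 0 D) {α : ℝ}
    (hα : TangentCondition D α) : IsBiLipschitzWith (lipL D α) (radialExt D 1) := by
  have hf : 0 < lipFactor α := by
    rw [lipFactor_eq hα.1.1 hα.1.2]; exact singMax_pos one_pos _
  have h1 : 0 < lipL1 D α := mul_pos (hD.rMax_pos hn) hf
  have h2 : 0 < lipL2 D α := mul_pos (one_div_pos.2 (hD.rMin_pos hn)) hf
  have hL : 0 < lipL D α := lt_max_of_lt_left h1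
  have hang := hD.isAngular_logRadius hn
  rw [hD.radialExt_eq_stretch hn]
  refine ⟨hL, (stretchHomeomorph one_pos hang).isHomeomorph, fun x y => ⟨?_, ?_⟩⟩
  · rw [div_le_iff₀' hL]
    have h3 := (hD.lipschitzWith_lipL2 hn hα).dist_le_mul
      (stretch 1 (logRadius D) x) (stretch 1 (logRadius D) y)
    rw [← stretchHomeomorph_symm_one hang, Real.coe_toNNReal _ h2.le] at h3
    have h4 : ∀ x, (stretchHomeomorph one_pos hang).symm (stretch 1 (logRadius D) x) = x :=
      (stretchHomeomorph one_pos hang).symm_apply_apply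
    rw [h4, h4] at h3
    exact h3.trans (mul_le_mul_of_nonneg_right (le_max_right _ _) dist_nonneg)
  · have h3 := (hD.lipschitzWith_lipL1 hn hα).dist_le_mul x y
    rw [Real.coe_toNNReal _ h1.le] at h3
    exact h3.trans (mul_le_mul_of_nonneg_right (le_max_left _ _) dist_nonneg)

theorem eq_one_of_isBiLipschitzWith (hn : 2 ≤ n) (hD : StrictlyStarlike 0 D) {a L : ℝ}
    (h : IsBiLipschitzWith L (radialExt D a)) : a = 1 := by
  rw [hD.radialExt_eq_stretch hn] at h
  obtain ⟨v, -, hv⟩ := hD.exists_ne_zero_mem hn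
  set ψ := logRadius D
  by_contra hne
  have hv' := norm_pos_iff.2 hv
  -- the point of norm `e ^ s` on the ray through `v`
  have key : ∀ s : ℝ, (a - 1) * s + ψ v ≤ Real.log L := fun s => by
    have hc : 0 < Real.exp s / ‖v‖ := by positivity
    have hx : (Real.exp s / ‖v‖) • v ≠ 0 := smul_ne_zero hc.ne' hv
    have hnx : ‖(Real.exp s / ‖v‖) • v‖ = Real.exp s := by
      rw [norm_smul, Real.norm_of_nonneg hc.le, div_mul_cancel₀ _ hv'.ne']
    have hsm : ψ ((Real.exp s / ‖v‖) • v) = ψ v := (hD.isAngular_logRadius hn).smul v _ hc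
    have h1 := (h.2.2 ((Real.exp s / ‖v‖) • v) 0).2
    rw [stretch_zero, dist_zero_right, dist_zero_right, norm_stretch a ψ hx, hnx, Real.log_exp,
      hsm] at h1
    have h2 := Real.log_le_log (Real.exp_pos _) h1
    rw [Real.log_exp, Real.log_mul h.1.ne' (Real.exp_pos s).ne', Real.log_exp] at h2
    linarith
  -- The affine function of s in `key` is bounded above on all of ℝ, so its slope a - 1 must vanish;
  -- at this s it would equal log L + 1.
  have h3 := key ((Real.log L - ψ v + 1) / (a - 1))
  rw [mul_div_cancel₀ _ (sub_ne_zero.2 hne)] at h3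
  linarith

theorem exists_tangentCondition_of_lipschitzWith (hn : 2 ≤ n) (hD : StrictlyStarlike 0 D) {K : ℝ≥0}
    (h : LipschitzWith K (stretch 1 (logRadius D))) : ∃ α, TangentCondition D α := by
  have hr := hD.rMin_pos hn
  -- With this slope, e^ψ S ≥ r_min · m/2 = K + 1 > K at every point.
  have hm : 0 ≤ 2 * ((K + 1) / rMin D) := by positivity
  obtain ⟨α, -, hα⟩ := hD.exists_tangentCondition hn hm fun x hx =>
    pointwiseLip_of_lipschitzWith hn (hD.isAngular_logRadius hn) h hx hm (by
      have h1 := half_le_singMax 1 (2 * ((K + 1) / rMin D))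
      have h2 := hD.rMin_le_exp_logRadius hn hx
      calc (K : ℝ) < K + 1 := by linarith
        _ = rMin D * ((K + 1) / rMin D) := by field_simp
        _ ≤ Real.exp (logRadius D x) * singMax 1 (2 * ((K + 1) / rMin D)) := by
          gcongr
          linarith)
  exact ⟨α, hα⟩

theorem exists_isBiLipschitzWith_iff (hn : 2 ≤ n) (hD : StrictlyStarlike 0 D) (a : ℝ) :
    (∃ L : ℝ, IsBiLipschitzWith L (radialExt D a)) ↔ (∃ α : ℝ, TangentCondition D α) ∧ a = 1 := by
  constructor
  · rintro ⟨L, hL⟩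
    obtain rfl := hD.eq_one_of_isBiLipschitzWith hn hL
    refine ⟨hD.exists_tangentCondition_of_lipschitzWith hn (K := L.toNNReal) ?_, rfl⟩
    rw [← hD.radialExt_eq_stretch hn]
    refine LipschitzWith.of_dist_le_mul fun x y => ?_
    rw [Real.coe_toNNReal _ hL.1.le]
    exact (hL.2.2 x y).2
  · rintro ⟨⟨α, hα⟩, rfl⟩
    exact ⟨_, hD.isBiLipschitzWith_lipL hn hα⟩

theorem exists_homeomorph_lip (hn : 2 ≤ n) (hD : StrictlyStarlike 0 D) {α : ℝ}
    (hα : TangentCondition D α) :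
    ∃ e : E n ≃ₜ E n, (∀ x, e x = radialExt D 1 x) ∧
      lip e = ⨆ x : frontier D, ENNReal.ofReal (‖(x : E n)‖ * lipFactor (tangentAngle D x)) ∧
      lip e ≤ ENNReal.ofReal (lipL1 D α) ∧
      lip e.symm = ⨆ x : frontier D,
        ENNReal.ofReal (1 / ‖(x : E n)‖ * lipFactor (tangentAngle D x)) ∧
      lip e.symm ≤ ENNReal.ofReal (lipL2 D α) := by
  have hang := hD.isAngular_logRadius hn
  have he : ⇑(stretchHomeomorph one_pos hang) = stretch 1 (logRadius D) := rfl
  refine ⟨stretchHomeomorph one_pos hang, fun x => by rw [hD.radialExt_eq_stretch hn]; rfl,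
    ?_, ?_, ?_, ?_⟩
  · rw [he, hD.lip_stretch_one hn hα hang fun _ _ => Iff.rfl]
    congr! 4 with x
    exact hD.exp_logRadius_of_mem_frontier hn x.2
  · rw [he]
    exact lip_le_of_lipschitzWith (hD.lipschitzWith_lipL1 hn hα)
  · rw [stretchHomeomorph_symm_one, hD.lip_stretch_one hn hα hang.neg pointwiseLip_neg_iff]
    congr! 4 with x
    rw [Real.exp_neg, hD.exp_logRadius_of_mem_frontier hn x.2, one_div]
  · rw [stretchHomeomorph_symm_one]
    exact lip_le_of_lipschitzWith (hD.lipschitzWith_lipL2 hn hα)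

/-! ### Quasiconformality -/

theorem isQuasiconformalWith_qcK_iff (hn : 2 ≤ n) (hD : StrictlyStarlike 0 D) {a α : ℝ}
    (ha : 0 < a) (h0 : 0 < α) (h1 : α ≤ Real.pi / 2) :
    IsQuasiconformalWith (qcK a α) (radialExt D a) ↔ TangentCondition D α := by
  rw [hD.tangentCondition_iff hn h0 h1, hD.radialExt_eq_stretch hn, qcK_eq]
  have hang := hD.isAngular_logRadius hn
  have hcot := cot_nonneg_of_le h0 h1
  exact ⟨fun h x hx => pointwiseLip_of_isQuasiconformalWith hn hang ha h hcot le_rfl hx,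
    fun h => isQuasiconformalWith_stretch hn hang ha hcot h⟩

theorem exists_isQuasiconformalWith_iff (hn : 2 ≤ n) (hD : StrictlyStarlike 0 D) {a : ℝ}
    (ha : 0 < a) : (∃ K : ℝ, IsQuasiconformalWith K (radialExt D a)) ↔
      ∃ α : ℝ, TangentCondition D α := by
  constructor
  · rintro ⟨K, hK⟩
    rw [hD.radialExt_eq_stretch hn] at hK
    -- Then S ≥ max(1, Ka), so S² ≥ Ka and the slope is admissible for K.
    have hm : 0 ≤ 2 * max 1 (K * a) := by positivity
    obtain ⟨α, -, hα⟩ := hD.exists_tangentCondition hn hm fun x hx =>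
      pointwiseLip_of_isQuasiconformalWith hn (hD.isAngular_logRadius hn) ha hK hm (by
        rw [le_div_iff₀ ha]
        have h1 := half_le_singMax a (2 * max 1 (K * a))
        have h2 := le_max_left 1 (K * a)
        have h3 := le_max_right 1 (K * a)
        nlinarith) hx
    exact ⟨α, hα⟩
  · rintro ⟨α, hα⟩
    exact ⟨_, (hD.isQuasiconformalWith_qcK_iff hn ha hα.1.1 hα.1.2).2 hα⟩

theorem isLeast_qcK (hn : 2 ≤ n) (hD : StrictlyStarlike 0 D) {a α : ℝ} (ha : 0 < a)
    (hα : IsGreatest {β : ℝ | TangentCondition D β} α) :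
    IsLeast {K : ℝ | IsQuasiconformalWith K (radialExt D a)} (qcK a α) := by
  obtain ⟨hT, hmax⟩ := hα
  have hT' : TangentCondition D α := hT
  obtain ⟨h0, h1⟩ := hT'.1
  refine ⟨(hD.isQuasiconformalWith_qcK_iff hn ha h0 h1).2 hT, fun K hK => ?_⟩
  have hK' : IsQuasiconformalWith K (stretch a (logRadius D)) := by
    rw [← hD.radialExt_eq_stretch hn]; exact hK
  have hang := hD.isAngular_logRadius hn
  by_contra! hlt
  rw [qcK_eq] at hlt
  rcases (cot_nonneg_of_le h0 h1).eq_or_lt with hcot | hcot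
  · rw [← hcot] at hlt
    linarith [singMax_zero_le_of_isQuasiconformalWith hn hang ha hK']
  · have hcont : ContinuousAt (fun m => singMax a m ^ 2 / a) (Real.cot α) :=
      (((continuous_singMax a).pow 2).div_const a).continuousAt
    obtain ⟨m, hm1, hm0, hm2⟩ := ((hcont.eventually (lt_mem_nhds hlt)).filter_mono
      nhdsWithin_le_nhds |>.and ((eventually_nhdsWithin_of_eventually_nhds
        (lt_mem_nhds hcot)).and self_mem_nhdsWithin)).exists (f := 𝓝[<] (Real.cot α))
    obtain ⟨γ, rfl, hγ⟩ := hD.exists_tangentCondition hn hm0.le fun x hx =>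
      pointwiseLip_of_isQuasiconformalWith hn hang ha hK' hm0.le hm1.le hx
    have h4 : γ ≤ α := hmax hγ
    rw [← cot_le_cot_iff h0 h1 hγ.1.1 hγ.1.2] at h4
    exact (mem_Iio.1 hm2).not_ge h4

theorem isQuasiconformalWith_cot_half (hn : 2 ≤ n) (hD : StrictlyStarlike 0 D) {α : ℝ}
    (hα : TangentCondition D α) :
    IsQuasiconformalWith (Real.cot (α / 2)) (radialExt D (csc α)) := by
  rw [← qcK_csc hα.1.1 hα.1.2]
  exact (hD.isQuasiconformalWith_qcK_iff hn (csc_pos hα.1.1 hα.1.2) hα.1.1 hα.1.2).2 hα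

theorem isLeast_cot_half (hn : 2 ≤ n) (hD : StrictlyStarlike 0 D) {α : ℝ}
    (hα : IsGreatest {β : ℝ | TangentCondition D β} α) :
    IsLeast {K : ℝ | ∃ a : ℝ, 0 < a ∧ IsQuasiconformalWith K (radialExt D a)}
      (Real.cot (α / 2)) := by
  have hT : TangentCondition D α := hα.1
  obtain ⟨h0, h1⟩ := hT.1
  refine ⟨⟨csc α, csc_pos h0 h1, hD.isQuasiconformalWith_cot_half hn hT⟩, ?_⟩
  rintro K ⟨a, ha, hK⟩
  rw [← qcK_csc h0 h1]
  exact (qcK_csc_le ha h0 h1).trans ((hD.isLeast_qcK hn ha hα).2 hK)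

/-! ### Almost orthogonal domains -/

/-- The chord [u, v] stays at distance at least 1/2 from the origin, so the pointwise constant along
it is at most 2m, and its length is at most 2. -/
theorem abs_sub_le_of_inner_nonneg {ψ : E n → ℝ} {m : ℝ} (hm : 0 ≤ m)
    (h : ∀ x, x ≠ 0 → PointwiseLip ψ x (m / ‖x‖)) {u v : E n} (hu : ‖u‖ = 1) (hv : ‖v‖ = 1)
    (huv : 0 ≤ inner ℝ u v) : |ψ v - ψ u| ≤ 4 * m := by
  have hseg : ∀ z ∈ segment ℝ u v, PointwiseLip ψ z (m / (1 / 2)) := by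
    rintro z ⟨s, t, hs, ht, hst, rfl⟩
    have h1 : ‖s • u + t • v‖ ^ 2 = s ^ 2 + t ^ 2 + 2 * (s * t * inner ℝ u v) := by
      rw [norm_add_sq_real, norm_smul, norm_smul, inner_smul_left, inner_smul_right, hu, hv,
        Real.norm_of_nonneg hs, Real.norm_of_nonneg ht]
      simp only [conj_trivial]
      ring
    have h2 : 0 ≤ s * t * inner ℝ u v := by positivity
    have h3 : (1 / 2 : ℝ) ≤ ‖s • u + t • v‖ := by
      refine abs_le_of_sq_le_sq' ?_ (norm_nonneg _) |>.2
      rw [h1]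
      nlinarith [sq_nonneg (s - t)]
    refine (h _ (norm_pos_iff.1 (by linarith))).mono ?_
    gcongr
  have h4 := norm_sub_le_of_pointwiseLip hseg
  have h5 : ‖v - u‖ ≤ 2 := (norm_sub_le v u).trans (by rw [hu, hv]; norm_num)
  rw [Real.norm_eq_abs] at h4
  have h6 : m / (1 / 2) * ‖v - u‖ ≤ m / (1 / 2) * 2 := by gcongr
  linarith

/-- Two chords through an intermediate direction w avoid the origin: w = u + v, or any w ⟂ u when u
and v are antipodal. -/
theorem abs_sub_le_of_unit (hn : 2 ≤ n) {ψ : E n → ℝ} {m : ℝ} (hm : 0 ≤ m)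
    (h : ∀ x, x ≠ 0 → PointwiseLip ψ x (m / ‖x‖)) {u v : E n} (hu : ‖u‖ = 1) (hv : ‖v‖ = 1) :
    |ψ v - ψ u| ≤ 8 * m := by
  obtain ⟨w, hw, huw, hwv⟩ : ∃ w : E n, w ≠ 0 ∧ 0 ≤ inner ℝ u w ∧ 0 ≤ inner ℝ w v := by
    have habs := abs_le.1 (abs_real_inner_le_norm u v)
    rw [hu, hv] at habs
    rcases eq_or_ne (u + v) 0 with h0 | h0
    · obtain ⟨w, hw, huw⟩ := exists_ne_zero_inner_eq_zero hn u
      refine ⟨w, hw, huw.ge, ?_⟩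
      rw [eq_neg_of_add_eq_zero_right h0, inner_neg_right, real_inner_comm, huw, neg_zero]
    · refine ⟨u + v, h0, ?_, ?_⟩
      · rw [inner_add_right, real_inner_self_eq_norm_sq, hu]; linarith [habs.1]
      · rw [inner_add_left, real_inner_self_eq_norm_sq, hv]; linarith [habs.1]
  have hw1 : ‖‖w‖⁻¹ • w‖ = 1 := by simp [norm_smul, hw]
  have h1 := abs_sub_le_of_inner_nonneg hm h hu hw1 (by rw [inner_smul_right]; positivity)
  have h2 := abs_sub_le_of_inner_nonneg hm h hw1 hv (by
    rw [inner_smul_left]; simp only [conj_trivial]; positivity)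
  have h3 := abs_sub_le (ψ v) (ψ (‖w‖⁻¹ • w)) (ψ u)
  linarith

theorem rMax_le (hn : 2 ≤ n) (hD : StrictlyStarlike 0 D) {α : ℝ} (hα : TangentCondition D α) :
    rMax D ≤ rMin D * Real.exp (8 * Real.cot α) := by
  obtain ⟨h0, h1⟩ := hα.1
  have := nonempty_sphere hn
  have hr : ∀ u : Metric.sphere (0 : E n) 1, polarRadius D u = Real.exp (logRadius D u) := by
    intro u
    have h1 : ‖(u : E n)‖ = 1 := by simp
    rw [hD.exp_logRadius hn (norm_ne_zero_iff.1 (by rw [h1]; exact one_ne_zero)), h1, inv_one,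
      one_smul]
  refine ciSup_le fun u => ?_
  rw [← div_le_iff₀ (Real.exp_pos _)]
  refine le_ciInf fun v => ?_
  rw [div_le_iff₀ (Real.exp_pos _), hr, hr, ← Real.exp_add, Real.exp_le_exp]
  have h2 := abs_sub_le_of_unit hn (cot_nonneg_of_le h0 h1)
    ((hD.tangentCondition_iff hn h0 h1).1 hα) (u := (v : E n)) (v := (u : E n)) (by simp) (by simp)
  linarith [le_abs_self (logRadius D (u : E n) - logRadius D (v : E n))]

theorem le_lipL (hn : 2 ≤ n) (hD : StrictlyStarlike 0 D) {α : ℝ} (hα : TangentCondition D α) :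
    max (rMin D) (1 / rMin D) ≤ lipL D α := by
  have hf : 1 ≤ lipFactor α := by rw [lipFactor_eq hα.1.1 hα.1.2]; exact one_le_singMax _ _
  have hr := hD.rMin_pos hn
  obtain ⟨v, -, hv⟩ := hD.exists_ne_zero_mem hn
  have hle := (hD.rMin_le_exp_logRadius hn hv).trans (hD.exp_logRadius_le_rMax hn hv)
  exact max_le_max (hle.trans (le_mul_of_one_le_right (hr.le.trans hle) hf))
    (le_mul_of_one_le_right (one_div_pos.2 hr).le hf)

/-- Together with `le_lipL` this encloses L between bounds that depend on D only through d = r_min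
and α, and whose ratio tends to 1 as α → π/2; hence the uniformity over D. -/
theorem lipL_le (hn : 2 ≤ n) (hD : StrictlyStarlike 0 D) {α : ℝ} (hα : TangentCondition D α) :
    lipL D α ≤ max (rMin D) (1 / rMin D) * (Real.exp (8 * Real.cot α) * singMax 1 (Real.cot α)) := by
  obtain ⟨h0, h1⟩ := hα.1
  have hr := hD.rMin_pos hn
  have hs := singMax_pos one_pos (Real.cot α)
  have hcot := cot_nonneg_of_le h0 h1
  have he : 1 ≤ Real.exp (8 * Real.cot α) := Real.one_le_exp (by linarith)
  rw [lipL, lipL1, lipL2, lipFactor_eq h0 h1, ← mul_assoc]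
  refine max_le ?_ ?_
  · gcongr
    exact (hD.rMax_le hn hα).trans (by gcongr; exact le_max_left _ _)
  · gcongr
    refine (le_max_right (rMin D) (1 / rMin D)).trans (le_mul_of_one_le_right ?_ he)
    exact hr.le.trans (le_max_left _ _)

end StrictlyStarlike

theorem exists_abs_lipL_sub_lt (hn : 2 ≤ n) {d : ℝ} {ε : ℝ} (hε : 0 < ε) :
    ∃ δ : ℝ, 0 < δ ∧ ∀ (D : Set (E n)) (α : ℝ), StrictlyStarlike 0 D → TangentCondition D α →
      Metric.infDist 0 (frontier D) = d → Real.pi / 2 - δ < α →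
        |lipL D α - max d (1 / d)| < ε := by
  have hcont : ContinuousAt (fun α => max d (1 / d) *
      (Real.exp (8 * Real.cot α) * singMax 1 (Real.cot α))) (Real.pi / 2) := by
    have hcot : ContinuousAt Real.cot (Real.pi / 2) := by
      have : Real.cot = fun x => Real.cos x / Real.sin x := funext Real.cot_eq_cos_div_sin
      rw [this]
      exact Real.continuous_cos.continuousAt.div Real.continuous_sin.continuousAt (by simp)
    exact continuousAt_const.mul ((continuousAt_const.mul hcot).rexp.mul
      ((continuous_singMax 1).continuousAt.comp hcot))
  have hval : max d (1 / d) * (Real.exp (8 * Real.cot (Real.pi / 2)) *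
      singMax 1 (Real.cot (Real.pi / 2))) = max d (1 / d) := by
    simp [Real.cot_eq_cos_div_sin, singMax]
  obtain ⟨δ, hδ, h⟩ := Metric.eventually_nhds_iff.1 (hcont.eventually
    (gt_mem_nhds (show _ < max d (1 / d) + ε by dsimp only; rw [hval]; linarith)))
  refine ⟨δ, hδ, fun D α hD hα hd hlt => ?_⟩
  rw [hD.infDist_eq_rMin hn] at hd
  have h1 := hD.le_lipL hn hα
  have h2 := hD.lipL_le hn hα
  rw [hd] at h1 h2
  have h3 := h (y := α) (by
    rw [Real.dist_eq, abs_lt]; constructor <;> linarith [hα.1.2])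
  rw [abs_lt]
  constructor <;> linarith

end RadialStretch

theorem mainTheorem5 (n : ℕ) (hn : 3 ≤ n) :
    (∀ D : Set (E n), StrictlyStarlike 0 D →
      -- (a): the characterization of bi-Lipschitz continuity
      (∀ a : ℝ, 0 < a →
        ((∃ L : ℝ, IsBiLipschitzWith L (radialExt D a)) ↔
          (∃ α : ℝ, TangentCondition D α) ∧ a = 1)) ∧
      -- (a): the Lipschitz constants of the map and of its inverse
      (∀ α : ℝ, TangentCondition D α →
        (∃ e : E n ≃ₜ E n, (∀ x, e x = radialExt D 1 x) ∧
          lip e = ⨆ x : frontier D,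
            ENNReal.ofReal (‖(x : E n)‖ * lipFactor (tangentAngle D x)) ∧
          lip e ≤ ENNReal.ofReal (lipL1 D α) ∧
          lip e.symm = ⨆ x : frontier D,
            ENNReal.ofReal (1 / ‖(x : E n)‖ * lipFactor (tangentAngle D x)) ∧
          lip e.symm ≤ ENNReal.ofReal (lipL2 D α)) ∧
        IsBiLipschitzWith (lipL D α) (radialExt D 1)) ∧
      -- (b): the characterization of quasiconformality, without and with the constant
      (∀ a : ℝ, 0 < a →
        ((∃ K : ℝ, IsQuasiconformalWith K (radialExt D a)) ↔
          ∃ α : ℝ, TangentCondition D α)) ∧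
      (∀ a α : ℝ, 0 < a → 0 < α → α ≤ Real.pi / 2 →
        (IsQuasiconformalWith (qcK a α) (radialExt D a) ↔ TangentCondition D α)) ∧
      -- (b): for the largest admissible angle, `K_a` is the best constant
      (∀ a α : ℝ, 0 < a → IsGreatest {β : ℝ | TangentCondition D β} α →
        IsLeast {K : ℝ | IsQuasiconformalWith K (radialExt D a)} (qcK a α)) ∧
      -- (b): the minimal constant is attained for `a = csc α`
      (∀ α : ℝ, TangentCondition D α →
        IsQuasiconformalWith (Real.cot (α / 2)) (radialExt D (csc α))) ∧
      (∀ α : ℝ, IsGreatest {β : ℝ | TangentCondition D β} α →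
        IsLeast {K : ℝ | ∃ a : ℝ, 0 < a ∧ IsQuasiconformalWith K (radialExt D a)}
          (Real.cot (α / 2)))) ∧
    -- (b): minimization of `K_a` over `a > 0`
    (∀ α : ℝ, 0 < α → α ≤ Real.pi / 2 →
      IsMinOn (fun a => qcK a α) (Set.Ioi 0) (csc α) ∧
        qcK (csc α) α = Real.cot (α / 2)) ∧
    -- (a): the limit of `L` as `α → π/2`, for domains with `dist(∂D, 0) = d`
    (∀ d : ℝ, 0 < d → ∀ ε : ℝ, 0 < ε → ∃ δ : ℝ, 0 < δ ∧
      ∀ (D : Set (E n)) (α : ℝ), StrictlyStarlike 0 D → TangentCondition D α →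
        Metric.infDist 0 (frontier D) = d → Real.pi / 2 - δ < α →
          |lipL D α - max d (1 / d)| < ε) := by
  have hn2 : 2 ≤ n := by omega
  refine ⟨fun D hD => ⟨fun a _ => hD.exists_isBiLipschitzWith_iff hn2 a,
    fun α hα => ⟨hD.exists_homeomorph_lip hn2 hα, hD.isBiLipschitzWith_lipL hn2 hα⟩,
    fun a ha => hD.exists_isQuasiconformalWith_iff hn2 ha,
    fun a α ha h0 h1 => hD.isQuasiconformalWith_qcK_iff hn2 ha h0 h1,
    fun a α ha hα => hD.isLeast_qcK hn2 ha hα,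
    fun α hα => hD.isQuasiconformalWith_cot_half hn2 hα,
    fun α hα => hD.isLeast_cot_half hn2 hα⟩,
    fun α h0 h1 => ⟨fun a ha => qcK_csc_le ha h0 h1, qcK_csc h0 h1⟩,
    fun d _ ε hε => exists_abs_lipL_sub_lt hn2 hε⟩
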